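/- Let $\mathbb{T}=\mathbb{R}/\mathbb{Z}$, $\tfrac12\le H<1$, and let $f\in L^2(\mathbb{T})$ (complex-valued) have Fourier coefficients $\hat f(n)=\int_{\mathbb{T}}f(t)e^{-2\pi i n t}\,dt$. Suppose that for some $\alpha>H$ and $K>0$, $$|\hat f(n)|\le K|n|^{-\alpha}\quad\text{for all } n\in\mathbb{Z},\ n\neq 0.$$ (a) Let $\Delta=(\Delta_n)_{n\in\mathbb{Z}}$ be a discrete complex fractional Gaussian noise of index $H$ on a probability space $(\Omega,\mathscr F,\mathbb{P})$, i.e. a complex Gaussian process with $\mathbb{E}\Delta_n=0$, $\mathbb{E}(\Delta_n\Delta_m)=0$ and $$\mathbb{E}(\Delta_n\overline{\Delta_m})=\gamma_H(n-m),\qquad \gamma_H(k)=\tfrac12|k+1|^{2H}+\tfrac12|k-1|^{2H}-|k|^{2H}.$$ Then for every $t\in\mathbb{T}$ the series $S(t)=\sum_{n\in\mathbb{Z}}\hat f(n)\Delta_n e^{2\pi i n t}$ converges (unconditionally) in $L^2(\mathbb{P})$, and the process $(S(t))_{t\in\mathbb{T}}$ is almost surely bounded, i.e. it has a modification whose paths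 $t\mapsto S(t)$ are almost surely bounded on $\mathbb{T}$. (b) If in addition $f$ is continuous and $\sum_{n\in\mathbb{Z}}|\hat f(n)|=\infty$, then $f\in\mathscr{P}(H)$ but $f\notin A(\mathbb{T})$. Here $A(\mathbb{T})$ is the Wiener algebra of continuous functions on $\mathbb{T}$ with absolutely convergent Fourier series. For a Borel probability measure $\mu$ on $\mathbb{T}$, $\mathscr{P}(\mu)$ is the class of those $g\in C(\mathbb{T})$ for which the centred complex Gaussian process $X_g=(X_g(t))_{t\in\mathbb{T}}$ with $\mathbb{E}\big(X_g(t)X_g(s)\big)=0$ and $\mathbb{E}\big(X_g(t)\overline{X_g(s)}\big)=\int_{\mathbb{T}}g(t+u)\overline{g(s+u)}\,d\mu(u)$ has (a modification with) almost surely bounded paths; and $\mathscr{P}(H)=\mathscr{P}(\mu_H)$, where $\mu_H$ is the spectral measure of $\Delta$, i.e. the Borel probability measure on $\mathbb{T}$ with $\int_{\mathbb{T}}e^{2\pi i k t}\,d\mu_H(t)=\gamma_H(k)$ for all $k\in\mathbb{Z}$. -/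

import Mathlib

open MeasureTheory ProbabilityTheory Filter Topology ComplexConjugate

noncomputable section

/-- The autocovariance of fractional Gaussian noise with Hurst index `H > 0`. -/
def fgnCov (H : ℝ) (k : ℤ) : ℝ :=
  |(k : ℝ) + 1| ^ (2 * H) / 2 + |(k : ℝ) - 1| ^ (2 * H) / 2 - |(k : ℝ)| ^ (2 * H)

/-- `X` is a centred (circularly symmetric) complex Gaussian process with covariance
`𝔼 (X s * conj (X t)) = Γ s t`. All the integrals below converge, because jointly Gaussian
variables have moments of all orders. -/
structure IsComplexGaussianProcess {T Ω : Type*} [MeasurableSpace Ω]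
    (X : T → Ω → ℂ) (Γ : T → T → ℂ) (P : Measure Ω) : Prop where
  gaussian : IsGaussianProcess X P
  mean : ∀ t, ∫ ω, X t ω ∂P = 0
  cov : ∀ s t, ∫ ω, X s ω * conj (X t ω) ∂P = Γ s t
  pseudoCov : ∀ s t, ∫ ω, X s ω * X t ω ∂P = 0

/-- `Δ = (Δ n)`, `n ∈ ℤ`, is a discrete complex fractional Gaussian noise of index `H`. -/
def IsFractionalGaussianNoise {Ω : Type*} [MeasurableSpace Ω]
    (H : ℝ) (Δ : ℤ → Ω → ℂ) (P : Measure Ω) : Prop :=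
  IsComplexGaussianProcess Δ (fun n m => (fgnCov H (n - m) : ℂ)) P

/-- The process `X`, whose variables are given up to null sets (elements of `L²(P)`), has
almost surely bounded paths: some modification of it has. -/
def HasBoundedPaths {T Ω : Type*} [MeasurableSpace Ω] (X : T → Ω → ℂ) (P : Measure Ω) : Prop :=
  ∃ Y : T → Ω → ℂ, (∀ t, Y t =ᵐ[P] X t) ∧ ∀ᵐ ω ∂P, ∃ C : ℝ, ∀ t, ‖Y t ω‖ ≤ C

/-- For every `t`, `S t` is the sum in `L²(P)` of the random Fourier series
`∑ f̂(n) ξ_n e^{2πint}` over `n ∈ ℤ`. -/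
def IsRandomFourierSum {Ω : Type*} [MeasurableSpace Ω] (f : UnitAddCircle → ℂ)
    (ξ : ℤ → Ω → ℂ) (P : Measure Ω) (S : UnitAddCircle → Ω → ℂ) : Prop :=
  ∀ t, MemLp (S t) 2 P ∧
    Tendsto (fun F : Finset ℤ =>
      eLpNorm (fun ω => ∑ n ∈ F, fourierCoeff f n * ξ n ω * fourier n t - S t ω) 2 P)
      atTop (𝓝 0)

/-- The class `𝒫(μ)` of the continuous functions `f` whose Gaussian process `X_f`, with
`𝔼 (X_f(t) * conj (X_f(s))) = ∫ f(t+u) conj (f(s+u)) dμ(u)`, has almost surely bounded paths.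
The covariance determines the law of `X_f`, hence the choice of `X_f` is immaterial. -/
def pisierClass (μ : Measure UnitAddCircle) : Set C(UnitAddCircle, ℂ) :=
  {f | ∃ (Ω : Type) (_ : MeasurableSpace Ω) (P : Measure Ω) (X : UnitAddCircle → Ω → ℂ),
    IsProbabilityMeasure P ∧
    IsComplexGaussianProcess X (fun t s => ∫ u, f (t + u) * conj (f (s + u)) ∂μ) P ∧
    HasBoundedPaths X P}

/-- `μ` is the spectral measure of a stationary process with autocovariance `γ`. -/
def IsSpectralMeasure (γ : ℤ → ℂ) (μ : Measure UnitAddCircle) : Prop :=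
  IsProbabilityMeasure μ ∧ ∀ k : ℤ, ∫ t, (fourier k t : ℂ) ∂μ = γ k

/-- The class `𝒫(H) = 𝒫(μ)`, with `μ` the (unique) spectral measure of the fractional
Gaussian noise of index `H`. -/
def pisierClassFGN (H : ℝ) : Set C(UnitAddCircle, ℂ) :=
  {f | ∃ μ : Measure UnitAddCircle,
    IsSpectralMeasure (fun k => (fgnCov H k : ℂ)) μ ∧ f ∈ pisierClass μ}

/-- The Wiener algebra: continuous functions with absolutely convergent Fourier series. -/
def wienerAlgebra : Set C(UnitAddCircle, ℂ) :=
  {f | Summable fun n : ℤ => ‖fourierCoeff f n‖}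

end

/-! The coefficients are cut into dyadic blocks `2 ^ j ≤ |n| < 2 ^ (j + 1)`. For `H ≥ 1/2` the
covariances are nonnegative, so the variance of a block is at most the square of its largest
coefficient times the sum of all covariances between its frequencies. That sum telescopes to a power
`N ^ (2H)` of the length `N`, whence block `j` of `S(t)` has `L²` norm at most `8 K' 2 ^ ((H - α)
j)` for every `t` (`norm_sum_block_le`). This decays geometrically because `α > H`, which gives
unconditional convergence in `L²`.

For boundedness, a `p`-th moment replaces the maximum over `t`. A block is a trigonometric
polynomial of degree at most `2 ^ (j + 1)`, and the `p`-th power of its maximum is at most the sum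
of the `p`-th powers of about `4p 2 ^ j` sampled values (`exists_trigPoly_sample`). Gaussian moments
are controlled by the `L²` norm, so for large `p` the geometric decay beats the number of samples,
and the suprema of the blocks are almost surely summable (`ae_exists_summable_bound_dyadicPart`).

For (b), the spectral measure `μ` is constructed explicitly and is absolutely continuous. With `W`
an isonormal process over `L²(μ)`, the variables `W(e_n)` form a fractional Gaussian noise and `t ↦
W(f(t + ·))` is a version of `X_f`. The Fourier series of each translate converges to it in `L²(μ)`,
so `X_f` is a modification of `S` and (a) applies. -/

/-! ### Positivity and sums of the covariance -/

lemma fgnCov_nonneg {H : ℝ} (hH : 1 / 2 ≤ H) (k : ℤ) : 0 ≤ fgnCov H k := by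
  have h1 : |(k : ℝ)| ≤ |(k : ℝ) + 1| / 2 + |(k : ℝ) - 1| / 2 := by
    have h := abs_add_le ((k : ℝ) + 1) ((k : ℝ) - 1)
    have h2 : |((k : ℝ) + 1) + ((k : ℝ) - 1)| = 2 * |(k : ℝ)| := by
      rw [show ((k : ℝ) + 1) + ((k : ℝ) - 1) = 2 * k by ring, abs_mul]; norm_num
    linarith
  have h2 : |(k : ℝ)| ^ (2 * H) ≤ (|(k : ℝ) + 1| / 2 + |(k : ℝ) - 1| / 2) ^ (2 * H) :=
    Real.rpow_le_rpow (abs_nonneg _) h1 (by linarith)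
  -- Convexity requires `2H ≥ 1`. Apart from uses of this positivity, only `H > 0` is needed of the
  -- lower bound on `H`.
  obtain ⟨-, hconv⟩ := convexOn_rpow (p := 2 * H) (by linarith)
  have h3 := hconv (Set.mem_Ici.2 (abs_nonneg ((k : ℝ) + 1)))
    (Set.mem_Ici.2 (abs_nonneg ((k : ℝ) - 1))) (by norm_num : (0 : ℝ) ≤ 1 / 2)
    (by norm_num : (0 : ℝ) ≤ 1 / 2) (by norm_num)
  simp only [smul_eq_mul] at h3
  rw [show 1 / 2 * |(k : ℝ) + 1| + 1 / 2 * |(k : ℝ) - 1| = |(k : ℝ) + 1| / 2 + |(k : ℝ) - 1| / 2 by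
    ring] at h3
  unfold fgnCov
  linarith

/-- The covariance is a second difference of `|x| ^ (2H) / 2`, so both sums telescope.
Probabilistically this is the variance of fractional Brownian motion at time `N`. -/
lemma sum_range_fgnCov {H : ℝ} (hH : 0 < H) (N : ℕ) :
    ∑ n ∈ Finset.range N, ∑ m ∈ Finset.range N, fgnCov H ((n : ℤ) - m) = (N : ℝ) ^ (2 * H) := by
  set g : ℝ → ℝ := fun x => |x| ^ (2 * H) / 2 with hg
  have key : ∀ n : ℕ, ∑ m ∈ Finset.range N, fgnCov H ((n : ℤ) - m)
      = (g (n + 1) - g n) - (g (n + 1 - N) - g (n - N)) := by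
    intro n
    have h := Finset.sum_range_sub' (fun m : ℕ => g (n + 1 - m) - g (n - m)) N
    simp only [Nat.cast_zero, sub_zero] at h
    rw [← h]
    refine Finset.sum_congr rfl fun m _ => ?_
    simp only [fgnCov, hg]
    push_cast
    rw [show (n : ℝ) + 1 - (m + 1) = n - m by ring, show (n : ℝ) - (m + 1) = n - m - 1 by ring,
      show (n : ℝ) + 1 - m = n - m + 1 by ring]
    ring
  simp_rw [key]
  rw [Finset.sum_sub_distrib]
  have h1 := Finset.sum_range_sub (fun m : ℕ => g m) N
  have h2 := Finset.sum_range_sub (fun m : ℕ => g (m - N)) N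
  push_cast at h1 h2
  rw [h1, h2]
  have h0 : g 0 = 0 := by simp [hg, Real.zero_rpow (by positivity : 2 * H ≠ 0)]
  have hN : g (0 - N) = g N := by simp [hg]
  rw [sub_self, hN, h0]
  simp [hg]

lemma sum_fgnCov_le {H : ℝ} (hH : 1 / 2 ≤ H) (M : ℕ) {F : Finset ℤ}
    (hF : F ⊆ Finset.Icc (-(M : ℤ)) M) :
    ∑ n ∈ F, ∑ m ∈ F, fgnCov H (n - m) ≤ ((2 * M + 1 : ℕ) : ℝ) ^ (2 * H) := by
  rw [← sum_range_fgnCov (by linarith)]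
  let φ : ℕ → ℤ := fun n => (n : ℤ) - M
  have hφ : Function.Injective φ := fun a b h => by simpa [φ] using h
  have hsub : F ⊆ (Finset.range (2 * M + 1)).map ⟨φ, hφ⟩ := by
    intro n hn
    have := Finset.mem_Icc.1 (hF hn)
    simp only [Finset.mem_map, Finset.mem_range, Function.Embedding.coeFn_mk, φ]
    exact ⟨(n + M).toNat, by omega, by omega⟩
  calc _ ≤ ∑ n ∈ (Finset.range (2 * M + 1)).map ⟨φ, hφ⟩,
        ∑ m ∈ (Finset.range (2 * M + 1)).map ⟨φ, hφ⟩, fgnCov H (n - m) := by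
        refine (Finset.sum_le_sum fun n _ => Finset.sum_le_sum_of_subset_of_nonneg hsub
          fun _ _ _ => fgnCov_nonneg hH _).trans ?_
        exact Finset.sum_le_sum_of_subset_of_nonneg hsub
          fun _ _ _ => Finset.sum_nonneg fun _ _ => fgnCov_nonneg hH _
    _ = _ := by
        simp [Finset.sum_map, φ]

/-! ### Dyadic blocks of frequencies -/

/-- The dyadic level of an integer: `n ≠ 0` has level `j` when `2 ^ j ≤ |n| < 2 ^ (j + 1)`. -/
def dyadicLevel (n : ℤ) : ℕ := Nat.log 2 n.natAbs

lemma abs_le_of_dyadicLevel (n : ℤ) : |n| ≤ ((2 ^ (dyadicLevel n + 1) : ℕ) : ℤ) := by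
  have h := Nat.lt_pow_succ_log_self (b := 2) (by norm_num) n.natAbs
  rw [Int.abs_eq_natAbs]
  exact_mod_cast h.le

lemma finite_dyadicLevel_lt (J : ℕ) : {n : ℤ | dyadicLevel n < J}.Finite := by
  refine (Set.finite_Icc (-((2 ^ J : ℕ) : ℤ)) ((2 ^ J : ℕ) : ℤ)).subset fun n hn => ?_
  have h := abs_le_of_dyadicLevel n
  have h2 : (2 : ℕ) ^ (dyadicLevel n + 1) ≤ 2 ^ J := Nat.pow_le_pow_right (by norm_num) hn
  exact abs_le.1 (h.trans (by exact_mod_cast h2))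

/-- The integers of level `j`. -/
noncomputable def dyadicBlock (j : ℕ) : Finset ℤ :=
  (finite_dyadicLevel_lt (j + 1)).toFinset.filter fun n => dyadicLevel n = j

lemma mem_dyadicBlock {j : ℕ} {n : ℤ} : n ∈ dyadicBlock j ↔ dyadicLevel n = j := by
  simp +contextual [dyadicBlock]

lemma dyadicBlock_subset (j : ℕ) :
    dyadicBlock j ⊆ Finset.Icc (-((2 ^ (j + 1) : ℕ) : ℤ)) ((2 ^ (j + 1) : ℕ) : ℤ) := by
  intro n hn
  have h := abs_le_of_dyadicLevel n
  rw [mem_dyadicBlock.1 hn] at h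
  exact Finset.mem_Icc.2 (abs_le.1 h)

lemma exists_dyadic_bound {a : ℤ → ℂ} {α K : ℝ} (hα : 0 < α)
    (ha : ∀ n : ℤ, n ≠ 0 → ‖a n‖ ≤ K * |(n : ℝ)| ^ (-α)) :
    ∃ K' : ℝ, 0 ≤ K' ∧ ∀ n, ‖a n‖ ≤ K' * ((2 : ℝ) ^ (-α)) ^ dyadicLevel n := by
  refine ⟨|K| + ‖a 0‖, by positivity, fun n => ?_⟩
  -- The decay hypothesis says nothing at `0`, which has level `0` since `Nat.log 2 0 = 0`; hence
  -- the term `‖a 0‖` in the constant.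
  by_cases hn : n = 0
  · subst hn; simp [dyadicLevel]
  have h1 : (2 : ℝ) ^ dyadicLevel n ≤ |(n : ℝ)| := by
    have := Nat.pow_log_le_self 2 (x := n.natAbs) (by simpa using hn)
    rw [← Int.cast_abs, Int.abs_eq_natAbs]
    exact_mod_cast this
  have h2 : |(n : ℝ)| ^ (-α) ≤ ((2 : ℝ) ^ (-α)) ^ dyadicLevel n := by
    rw [← Real.rpow_natCast, ← Real.rpow_mul (by norm_num), mul_comm, Real.rpow_mul (by norm_num),
      Real.rpow_natCast]
    exact Real.rpow_le_rpow_of_nonpos (by positivity) h1 (by linarith)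
  calc ‖a n‖ ≤ K * |(n : ℝ)| ^ (-α) := ha n hn
    _ ≤ |K| * |(n : ℝ)| ^ (-α) := by gcongr; exact le_abs_self K
    _ ≤ |K| * ((2 : ℝ) ^ (-α)) ^ dyadicLevel n := by gcongr
    _ ≤ _ := by gcongr; linarith [norm_nonneg (a 0)]

/-! ### Block estimates in a Hilbert space -/

section Hilbert

variable {E : Type*} [NormedAddCommGroup E] [InnerProductSpace ℂ E] {v : ℤ → E} {H α K : ℝ}
  {a : ℤ → ℂ}

lemma norm_sum_smul_sq_le (hH : 1 / 2 ≤ H)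
    (hv : ∀ n m, inner ℂ (v m) (v n) = (fgnCov H (n - m) : ℂ)) {A : ℝ} (M : ℕ) {F : Finset ℤ}
    (hF : F ⊆ Finset.Icc (-(M : ℤ)) M) (ha : ∀ n ∈ F, ‖a n‖ ≤ A) :
    ‖∑ n ∈ F, a n • v n‖ ^ 2 ≤ A ^ 2 * ((2 * M + 1 : ℕ) : ℝ) ^ (2 * H) := by
  have h1 : ‖∑ n ∈ F, a n • v n‖ ^ 2 = ‖inner ℂ (∑ n ∈ F, a n • v n) (∑ n ∈ F, a n • v n)‖ := by
    rw [inner_self_eq_norm_sq_to_K]; simp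
  rw [h1, sum_inner]
  simp_rw [inner_sum, inner_smul_left, inner_smul_right, hv]
  calc _ ≤ ∑ n ∈ F, ∑ m ∈ F, A ^ 2 * fgnCov H (m - n) := by
        refine (norm_sum_le _ _).trans (Finset.sum_le_sum fun n hn => (norm_sum_le _ _).trans
          (Finset.sum_le_sum fun m hm => ?_))
        rw [norm_mul, norm_mul, Complex.norm_real, Real.norm_of_nonneg (fgnCov_nonneg hH _),
          RCLike.norm_conj, sq, mul_assoc A]
        have := fgnCov_nonneg hH (m - n)
        have h0 := (norm_nonneg _).trans (ha n hn)
        gcongr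
        exacts [ha n hn, ha m hm]
    _ ≤ _ := by
        rw [Finset.sum_comm]
        simp_rw [← Finset.mul_sum]
        gcongr
        exact sum_fgnCov_le hH M hF

/-- The bound holds for every subset `F` of a block, which is what unconditional summability
requires. The constant arises from `2 * 2 ^ (j + 1) + 1 ≤ 8 * 2 ^ j` and `8 ^ (2H) ≤ 64`. -/
lemma norm_sum_block_le (hH : 1 / 2 ≤ H) (hH1 : H < 1)
    (hv : ∀ n m, inner ℂ (v m) (v n) = (fgnCov H (n - m) : ℂ)) (hK : 0 ≤ K)
    (ha : ∀ n, ‖a n‖ ≤ K * ((2 : ℝ) ^ (-α)) ^ dyadicLevel n) {j : ℕ} {F : Finset ℤ}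
    (hF : ∀ n ∈ F, dyadicLevel n = j) :
    ‖∑ n ∈ F, a n • v n‖ ≤ 8 * K * ((2 : ℝ) ^ (H - α)) ^ j := by
  have hsub : F ⊆ Finset.Icc (-((2 ^ (j + 1) : ℕ) : ℤ)) ((2 ^ (j + 1) : ℕ) : ℤ) :=
    fun n hn => dyadicBlock_subset j (mem_dyadicBlock.2 (hF n hn))
  have h := norm_sum_smul_sq_le hH hv (2 ^ (j + 1)) hsub (A := K * ((2 : ℝ) ^ (-α)) ^ j)
    (fun n hn => by simpa [hF n hn] using ha n)
  refine abs_le_of_sq_le_sq' (h.trans ?_) (by positivity) |>.2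
  have h8 : ((2 * 2 ^ (j + 1) + 1 : ℕ) : ℝ) ≤ 8 * 2 ^ j := by
    push_cast
    have : (1 : ℝ) ≤ 2 ^ j := one_le_pow₀ (by norm_num)
    rw [pow_succ]; linarith
  have h9 : ((2 * 2 ^ (j + 1) + 1 : ℕ) : ℝ) ^ (2 * H) ≤ 64 * (((2 : ℝ) ^ H) ^ j) ^ 2 := by
    calc _ ≤ (8 * 2 ^ j : ℝ) ^ (2 * H) := Real.rpow_le_rpow (by positivity) h8 (by linarith)
      _ = 8 ^ (2 * H) * (((2 : ℝ) ^ H) ^ j) ^ 2 := by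
        rw [Real.mul_rpow (by norm_num) (by positivity), ← Real.rpow_natCast 2 j,
          ← Real.rpow_mul (by norm_num), ← pow_mul, ← Real.rpow_natCast, ← Real.rpow_mul (by norm_num)]
        congr 2; push_cast; ring
      _ ≤ (8 : ℝ) ^ (2 : ℝ) * (((2 : ℝ) ^ H) ^ j) ^ 2 := by
        gcongr
        · norm_num
        · linarith
      _ = _ := by norm_num
  calc _ ≤ (K * ((2 : ℝ) ^ (-α)) ^ j) ^ 2 * (64 * (((2 : ℝ) ^ H) ^ j) ^ 2) := by gcongr
    _ = _ := by
      rw [sub_eq_add_neg, Real.rpow_add (by norm_num), mul_pow]; ring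

lemma two_rpow_sub_lt_one (hα : H < α) : (2 : ℝ) ^ (H - α) < 1 :=
  Real.rpow_lt_one_of_one_lt_of_neg (by norm_num) (by linarith)

/-- Cauchy criterion: a finite set of frequencies avoiding all low levels splits into subsets of
blocks, whose norms are dominated by a tail of a geometric series. -/
lemma summable_smul_of_fgnCov [CompleteSpace E] (hH : 1 / 2 ≤ H) (hH1 : H < 1) (hα : H < α)
    (hv : ∀ n m, inner ℂ (v m) (v n) = (fgnCov H (n - m) : ℂ)) (hK : 0 ≤ K)
    (ha : ∀ n, ‖a n‖ ≤ K * ((2 : ℝ) ^ (-α)) ^ dyadicLevel n) :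
    Summable fun n => a n • v n := by
  have hs : Summable fun j : ℕ => 8 * K * ((2 : ℝ) ^ (H - α)) ^ j :=
    (summable_geometric_of_lt_one (by positivity) (two_rpow_sub_lt_one hα)).mul_left _
  rw [summable_iff_vanishing_norm]
  intro ε hε
  obtain ⟨s, hs⟩ := summable_iff_vanishing_norm.1 hs ε hε
  refine ⟨(finite_dyadicLevel_lt (s.sup id + 1)).toFinset, fun t ht => ?_⟩
  rw [← Finset.sum_fiberwise_of_maps_to (fun n hn => Finset.mem_image_of_mem dyadicLevel hn)]
  refine (norm_sum_le _ _).trans_lt (lt_of_le_of_lt ?_ (hs (t.image dyadicLevel) ?_))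
  · rw [Real.norm_of_nonneg (Finset.sum_nonneg fun _ _ => by positivity)]
    exact Finset.sum_le_sum fun j _ => norm_sum_block_le hH hH1 hv hK ha (by simp)
  · rw [Finset.disjoint_left]
    intro j hj hjs
    obtain ⟨n, hn, rfl⟩ := Finset.mem_image.1 hj
    refine Finset.disjoint_left.1 ht hn ?_
    simpa using Nat.lt_succ_of_le (Finset.le_sup (f := id) hjs)

end Hilbert

/-! ### Sampling of polynomials and trigonometric polynomials -/

/-- Discrete Fourier inversion recovers each of the `L` coefficients as an average over the roots of
unity, so each is at most `1 / L` times the right-hand side. -/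
lemma Polynomial.norm_eval_le_sum_roots_of_unity (R : Polynomial ℂ) {L : ℕ} (hL : R.natDegree < L)
    {ζ : ℂ} (hζ : IsPrimitiveRoot ζ L) {z : ℂ} (hz : ‖z‖ ≤ 1) :
    ‖R.eval z‖ ≤ ∑ i ∈ Finset.range L, ‖R.eval (ζ ^ i)‖ := by
  have hL0 : L ≠ 0 := by omega
  have hζ1 : ‖ζ‖ = 1 := Complex.norm_eq_one_of_pow_eq_one hζ.pow_eq_one hL0
  -- The exponent `L - k + l` represents `l - k` modulo `L` without truncated subtraction. It lies
  -- strictly between `0` and `2L`, so `L` divides it only when `l = k`.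
  have hgeom : ∀ k < L, ∀ l < L, ∑ i ∈ Finset.range L, ζ ^ (i * (L - k + l))
      = if l = k then (L : ℂ) else 0 := by
    intro k hk l hl
    have h1 : ∀ i, ζ ^ (i * (L - k + l)) = (ζ ^ (L - k + l)) ^ i := fun i => by
      rw [← pow_mul, mul_comm]
    simp_rw [h1]
    split_ifs with h
    · rw [h, Nat.sub_add_cancel hk.le, hζ.pow_eq_one]; simp
    · have hne : ζ ^ (L - k + l) ≠ 1 := by
        rw [Ne, hζ.pow_eq_one_iff_dvd]
        rintro ⟨q, hq⟩
        rcases Nat.lt_or_ge q 1 with h0 | h0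
        · obtain rfl : q = 0 := by omega
          omega
        · rcases Nat.lt_or_ge q 2 with h2 | h2
          · obtain rfl : q = 1 := by omega
            omega
          · have := Nat.mul_le_mul_left L h2
            omega
      have h3 := geom_sum_mul (ζ ^ (L - k + l)) L
      rw [← pow_mul, mul_comm _ L, pow_mul, hζ.pow_eq_one, one_pow, sub_self] at h3
      exact (mul_eq_zero.1 h3).resolve_right (sub_ne_zero.2 hne)
  have hcoeff : ∀ k < L, (L : ℝ) * ‖R.coeff k‖ ≤ ∑ i ∈ Finset.range L, ‖R.eval (ζ ^ i)‖ := by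
    intro k hk
    have h : (L : ℂ) * R.coeff k
        = ∑ i ∈ Finset.range L, ζ ^ (i * (L - k)) * R.eval (ζ ^ i) := by
      simp_rw [Polynomial.eval_eq_sum_range' hL, Finset.mul_sum]
      rw [Finset.sum_comm]
      have h2 : ∀ l ∈ Finset.range L,
          ∑ i ∈ Finset.range L, ζ ^ (i * (L - k)) * (R.coeff l * (ζ ^ i) ^ l)
            = R.coeff l * if l = k then (L : ℂ) else 0 := by
        intro l hl
        rw [← hgeom k hk l (Finset.mem_range.1 hl), Finset.mul_sum]
        refine Finset.sum_congr rfl fun i _ => ?_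
        rw [mul_add, pow_add, pow_mul ζ i l]; ring
      rw [Finset.sum_congr rfl h2]
      simp [hk, mul_comm]
    have h2 : (L : ℝ) * ‖R.coeff k‖ = ‖(L : ℂ) * R.coeff k‖ := by simp
    rw [h2, h]
    refine (norm_sum_le _ _).trans (Finset.sum_le_sum fun i _ => ?_)
    simp [hζ1]
  rw [Polynomial.eval_eq_sum_range' hL]
  have hLpos : (0 : ℝ) < L := by positivity
  calc _ ≤ ∑ k ∈ Finset.range L, ‖R.coeff k‖ := by
        refine (norm_sum_le _ _).trans (Finset.sum_le_sum fun k _ => ?_)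
        rw [norm_mul, norm_pow]
        exact mul_le_of_le_one_right (norm_nonneg _) (pow_le_one₀ (norm_nonneg _) hz)
    _ ≤ ∑ k ∈ Finset.range L, (∑ i ∈ Finset.range L, ‖R.eval (ζ ^ i)‖) / L := by
        refine Finset.sum_le_sum fun k hk => ?_
        rw [le_div_iff₀' hLpos]
        exact hcoeff k (Finset.mem_range.1 hk)
    _ = _ := by
        rw [Finset.sum_const, Finset.card_range, nsmul_eq_mul]
        field_simp

lemma norm_fourier_apply (n : ℤ) (t : UnitAddCircle) : ‖(fourier n t : ℂ)‖ = 1 :=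
  Circle.norm_coe _

lemma fourier_natCast_eq_pow (k : ℕ) (t : UnitAddCircle) :
    (fourier (k : ℤ) t : ℂ) = (fourier 1 t : ℂ) ^ k := by
  induction k with
  | zero => simp
  | succ k ih => push_cast; rw [fourier_add, ih, pow_succ]

/-- The maximum of a trigonometric polynomial is controlled by finitely many of its values. -/
lemma exists_trigPoly_sample (M p : ℕ) : ∃ τ : ℕ → UnitAddCircle, ∀ (F : Finset ℤ) (c : ℤ → ℂ),
    F ⊆ Finset.Icc (-(M : ℤ)) M → ∀ t : UnitAddCircle, ‖∑ n ∈ F, c n * fourier n t‖ ^ p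
      ≤ ∑ i ∈ Finset.range (2 * M * p + 1), ‖∑ n ∈ F, c n * fourier n (τ i)‖ ^ p := by
  set L := 2 * M * p + 1 with hLdef
  have hζ := Complex.isPrimitiveRoot_exp L (by omega)
  refine ⟨fun i => (((i : ℝ) / L : ℝ) : UnitAddCircle), fun F c hF t => ?_⟩
  -- Multiplication by `z ^ M` turns the trigonometric polynomial into an algebraic one of degree at
  -- most `2M` without changing its modulus on the circle. Sampling is applied to `Q ^ p`, of degree
  -- at most `2Mp < L`.
  let Q : Polynomial ℂ := ∑ n ∈ F, Polynomial.C (c n) * Polynomial.X ^ (n + M).toNat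
  have hdeg : (Q ^ p).natDegree < L := by
    have h1 : Q.natDegree ≤ 2 * M := by
      refine Polynomial.natDegree_sum_le_of_forall_le _ _ fun n hn => ?_
      refine (Polynomial.natDegree_C_mul_X_pow_le _ _).trans ?_
      have := Finset.mem_Icc.1 (hF hn)
      omega
    have h2 := Polynomial.natDegree_pow_le (p := Q) (n := p)
    have h3 := Nat.mul_le_mul_left p h1
    rw [hLdef, mul_comm (2 * M) p]
    omega
  have heval : ∀ s : UnitAddCircle,
      ‖(Q ^ p).eval (fourier 1 s : ℂ)‖ = ‖∑ n ∈ F, c n * fourier n s‖ ^ p := by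
    intro s
    have h1 : Q.eval (fourier 1 s : ℂ) = fourier (M : ℤ) s * ∑ n ∈ F, c n * fourier n s := by
      simp only [Q, Polynomial.eval_finsetSum, Polynomial.eval_mul, Polynomial.eval_C,
        Polynomial.eval_pow, Polynomial.eval_X, Finset.mul_sum]
      refine Finset.sum_congr rfl fun n hn => ?_
      have := Finset.mem_Icc.1 (hF hn)
      rw [← fourier_natCast_eq_pow, Int.toNat_of_nonneg (by omega), fourier_add]; ring
    rw [Polynomial.eval_pow, norm_pow, h1, norm_mul, norm_fourier_apply, one_mul]
  have hsample : ∀ i : ℕ, (fourier 1 (((i : ℝ) / L : ℝ) : UnitAddCircle) : ℂ)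
      = Complex.exp (2 * Real.pi * Complex.I / L) ^ i := by
    intro i
    rw [fourier_coe_apply, ← Complex.exp_nat_mul]
    congr 1
    push_cast
    ring
  rw [← heval]
  refine ((Q ^ p).norm_eval_le_sum_roots_of_unity hdeg hζ (norm_fourier_apply 1 t).le).trans ?_
  exact Finset.sum_le_sum fun i _ => by rw [← heval, hsample]

/-! ### Moments of Gaussian variables -/

/-- The absolute moment of order `p` of the standard normal distribution. -/
noncomputable def gaussianAbsMoment (p : ℕ) : ENNReal := ∫⁻ x, ‖x‖ₑ ^ p ∂gaussianReal 0 1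

lemma gaussianAbsMoment_ne_top (p : ℕ) : gaussianAbsMoment p ≠ ⊤ := by
  rcases Nat.eq_zero_or_pos p with rfl | hp
  · simp [gaussianAbsMoment]
  have h := (memLp_id_gaussianReal' (μ := 0) (v := 1) p (by simp)).2
  have h2 := lintegral_rpow_enorm_lt_top_of_eLpNorm_lt_top (by positivity) (by simp) h
  simpa [gaussianAbsMoment] using h2.ne

lemma lintegral_enorm_pow_gaussianReal (v : NNReal) (p : ℕ) :
    ∫⁻ x, ‖x‖ₑ ^ p ∂gaussianReal 0 v = gaussianAbsMoment p * ENNReal.ofReal √v ^ p := by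
  have h : gaussianReal 0 v = (gaussianReal 0 1).map (fun x => √v * x) := by
    rw [gaussianReal_map_const_mul]
    congr 1
    · simp
    · ext; simp
  rw [h, lintegral_map (by fun_prop) (by fun_prop), gaussianAbsMoment]
  simp_rw [enorm_mul, mul_pow]
  rw [lintegral_const_mul _ (by fun_prop), mul_comm, Real.enorm_of_nonneg (Real.sqrt_nonneg _)]

lemma lintegral_enorm_pow_le_of_hasGaussianLaw_real {Ω : Type*} [MeasurableSpace Ω]
    {P : Measure Ω} {X : Ω → ℝ} (hX : HasGaussianLaw X P) (h0 : ∫ ω, X ω ∂P = 0) (p : ℕ) :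
    ∫⁻ ω, ‖X ω‖ₑ ^ p ∂P ≤ gaussianAbsMoment p * eLpNorm X 2 P ^ p := by
  have := hX.isProbabilityMeasure
  have hm := hX.aemeasurable
  have hL2 : MemLp X 2 P := hX.memLp (by simp)
  have h1 : ∫⁻ ω, ‖X ω‖ₑ ^ p ∂P = ∫⁻ x, ‖x‖ₑ ^ p ∂(P.map X) := by
    rw [lintegral_map' (by fun_prop) hm]
  rw [h1, hX.map_eq_gaussianReal, h0, lintegral_enorm_pow_gaussianReal]
  gcongr
  rw [Real.coe_toNNReal _ (variance_nonneg _ _), variance_of_integral_eq_zero hm h0,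
    hL2.eLpNorm_eq_integral_rpow_norm (by simp) (by simp)]
  refine ENNReal.ofReal_le_ofReal ?_
  rw [Real.sqrt_eq_rpow]
  simp

/-- Real and imaginary parts are treated separately: `2 ^ p` comes from bounding the modulus by
twice their maximum, the further factor `2` from adding the two moments. -/
lemma lintegral_enorm_pow_le_of_hasGaussianLaw {Ω : Type*} [MeasurableSpace Ω]
    {P : Measure Ω} {X : Ω → ℂ} (hX : HasGaussianLaw X P) (h0 : ∫ ω, X ω ∂P = 0) (p : ℕ) :
    ∫⁻ ω, ‖X ω‖ₑ ^ p ∂P ≤ 2 ^ (p + 1) * gaussianAbsMoment p * eLpNorm X 2 P ^ p := by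
  have := hX.isProbabilityMeasure
  have hm := hX.aemeasurable
  have hint : Integrable X P := (hX.memLp (p := 1) (by simp)).integrable le_rfl
  have hre : HasGaussianLaw (fun ω => (X ω).re) P := hX.map Complex.reCLM
  have him : HasGaussianLaw (fun ω => (X ω).im) P := hX.map Complex.imCLM
  have hre0 : ∫ ω, (X ω).re ∂P = 0 := by
    have := integral_re hint; rw [h0] at this; simpa using this
  have him0 : ∫ ω, (X ω).im ∂P = 0 := by
    have := integral_im hint; rw [h0] at this; simpa using this
  have hmax : ∀ ω, ‖X ω‖ₑ ^ p ≤ 2 ^ p * (‖(X ω).re‖ₑ ^ p + ‖(X ω).im‖ₑ ^ p) := by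
    intro ω
    have h1 : ‖X ω‖ₑ ≤ 2 * max ‖(X ω).re‖ₑ ‖(X ω).im‖ₑ := by
      have h2 : ‖X ω‖ₑ ≤ ‖(X ω).re‖ₑ + ‖(X ω).im‖ₑ := by
        simp only [← ofReal_norm]
        rw [← ENNReal.ofReal_add (by positivity) (by positivity)]
        exact ENNReal.ofReal_le_ofReal (Complex.norm_le_abs_re_add_abs_im _)
      rw [two_mul]
      exact h2.trans (add_le_add (le_max_left _ _) (le_max_right _ _))
    calc _ ≤ (2 * max ‖(X ω).re‖ₑ ‖(X ω).im‖ₑ) ^ p := by gcongr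
      _ ≤ _ := by
        rw [mul_pow]
        gcongr
        rcases max_choice ‖(X ω).re‖ₑ ‖(X ω).im‖ₑ with h | h <;> rw [h]
        exacts [le_self_add, le_add_self]
  have e1 : eLpNorm (fun ω => (X ω).re) 2 P ≤ eLpNorm X 2 P :=
    eLpNorm_mono fun ω => by simpa using Complex.abs_re_le_norm (X ω)
  have e2 : eLpNorm (fun ω => (X ω).im) 2 P ≤ eLpNorm X 2 P :=
    eLpNorm_mono fun ω => by simpa using Complex.abs_im_le_norm (X ω)
  calc _ ≤ ∫⁻ ω, 2 ^ p * (‖(X ω).re‖ₑ ^ p + ‖(X ω).im‖ₑ ^ p) ∂P := lintegral_mono hmax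
    _ = 2 ^ p * (∫⁻ ω, ‖(X ω).re‖ₑ ^ p ∂P + ∫⁻ ω, ‖(X ω).im‖ₑ ^ p ∂P) := by
      rw [lintegral_const_mul' _ _ (by simp), lintegral_add_left' (by fun_prop)]
    _ ≤ 2 ^ p * (gaussianAbsMoment p * eLpNorm X 2 P ^ p
        + gaussianAbsMoment p * eLpNorm X 2 P ^ p) := by
      gcongr
      · exact (lintegral_enorm_pow_le_of_hasGaussianLaw_real hre hre0 p).trans (by gcongr)
      · exact (lintegral_enorm_pow_le_of_hasGaussianLaw_real him him0 p).trans (by gcongr)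
    _ = _ := by ring

/-! ### Series in `L²` and almost sure limits -/

section L2

variable {Ω : Type*} [MeasurableSpace Ω] {P : Measure Ω}

lemma inner_toLp_toLp {X Y : Ω → ℂ} (hX : MemLp X 2 P) (hY : MemLp Y 2 P) :
    inner ℂ (hY.toLp Y) (hX.toLp X) = ∫ ω, X ω * conj (Y ω) ∂P := by
  rw [L2.inner_def]
  refine integral_congr_ae ?_
  filter_upwards [hX.coeFn_toLp, hY.coeFn_toLp] with ω h1 h2
  rw [h1, h2]; rfl

lemma coeFn_sum_smul_toLp {ι : Type*} {ξ : ι → Ω → ℂ} (hξ : ∀ n, MemLp (ξ n) 2 P) (c : ι → ℂ)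
    (F : Finset ι) :
    ((∑ n ∈ F, c n • (hξ n).toLp (ξ n) : Lp ℂ 2 P) : Ω → ℂ)
      =ᵐ[P] fun ω => ∑ n ∈ F, c n * ξ n ω := by
  classical
  induction F using Finset.induction_on with
  | empty => simpa using! Lp.coeFn_zero ℂ 2 P
  | insert n F hn ih =>
    rw [Finset.sum_insert hn]
    filter_upwards [Lp.coeFn_add (c n • (hξ n).toLp (ξ n)) (∑ n ∈ F, c n • (hξ n).toLp (ξ n)),
      Lp.coeFn_smul (c n) ((hξ n).toLp (ξ n)), ih, (hξ n).coeFn_toLp] with ω h1 h2 h3 h4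
    rw [h1, Pi.add_apply, h2, h3, Pi.smul_apply, h4, Finset.sum_insert hn, smul_eq_mul]

lemma tendsto_eLpNorm_sum_sub {ι : Type*} {ξ : ι → Ω → ℂ} (hξ : ∀ n, MemLp (ξ n) 2 P)
    {c : ι → ℂ} {Z : Lp ℂ 2 P} (hZ : HasSum (fun n => c n • (hξ n).toLp (ξ n)) Z) :
    Tendsto (fun F : Finset ι => eLpNorm (fun ω => ∑ n ∈ F, c n * ξ n ω - Z ω) 2 P)
      atTop (𝓝 0) := by
  have h := tendsto_iff_edist_tendsto_0.1 hZ
  refine h.congr fun F => ?_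
  rw [Lp.edist_def]
  refine eLpNorm_congr_ae ?_
  filter_upwards [coeFn_sum_smul_toLp hξ c F] with ω hω
  rw [Pi.sub_apply, hω]

/-- An almost sure limit agrees with a limit in `L²`. -/
lemma ae_eq_of_tendsto_eLpNorm_of_tendsto_ae {T : ℕ → Ω → ℂ} {X Y : Ω → ℂ}
    (hT : ∀ n, AEStronglyMeasurable (T n) P) (hX : AEStronglyMeasurable X P)
    (h : Tendsto (fun n => eLpNorm (fun ω => T n ω - X ω) 2 P) atTop (𝓝 0))
    (hY : ∀ᵐ ω ∂P, Tendsto (fun n => T n ω) atTop (𝓝 (Y ω))) : Y =ᵐ[P] X := by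
  obtain ⟨ns, hns, hlim⟩ :=
    (tendstoInMeasure_of_tendsto_eLpNorm (by simp) hT hX h).exists_seq_tendsto_ae
  filter_upwards [hlim, hY] with ω h1 h2
  exact tendsto_nhds_unique (h2.comp hns.tendsto_atTop) h1

end L2

/-! ### The random Fourier series and its bounded modification -/

/-- The part of the random Fourier series with frequencies of dyadic level `j`. -/
noncomputable def dyadicPart {Ω : Type*} (a : ℤ → ℂ) (Δ : ℤ → Ω → ℂ) (j : ℕ) (t : UnitAddCircle) (ω : Ω) : ℂ :=
  ∑ n ∈ dyadicBlock j, a n * Δ n ω * fourier n t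

lemma sum_range_dyadicPart {Ω : Type*} {a : ℤ → ℂ} {Δ : ℤ → Ω → ℂ} (J : ℕ) (t : UnitAddCircle) (ω : Ω) :
    ∑ j ∈ Finset.range J, dyadicPart a Δ j t ω
      = ∑ n ∈ (finite_dyadicLevel_lt J).toFinset, a n * fourier n t * Δ n ω := by
  rw [← Finset.sum_fiberwise_of_maps_to (g := dyadicLevel) (t := Finset.range J)
    (fun n hn => by simpa using hn)]
  refine Finset.sum_congr rfl fun j hj => ?_
  have : dyadicBlock j = {n ∈ (finite_dyadicLevel_lt J).toFinset | dyadicLevel n = j} := by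
    ext n
    simp only [mem_dyadicBlock, Finset.mem_filter, Set.Finite.mem_toFinset, Set.mem_ofPred_eq,
      iff_and_self]
    rintro rfl
    exact Finset.mem_range.1 hj
  rw [dyadicPart, this]
  exact Finset.sum_congr rfl fun n _ => by ring

section FractionalGaussianNoise

variable {Ω : Type*} [MeasurableSpace Ω] {P : Measure Ω} {H α K : ℝ} {Δ : ℤ → Ω → ℂ}
  {a : ℤ → ℂ}

lemma IsFractionalGaussianNoise.memLp (hΔ : IsFractionalGaussianNoise H Δ P) (n : ℤ) :
    MemLp (Δ n) 2 P :=
  (hΔ.gaussian.hasGaussianLaw_eval n).memLp (by simp)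

lemma IsFractionalGaussianNoise.inner_toLp (hΔ : IsFractionalGaussianNoise H Δ P) (n m : ℤ) :
    inner ℂ ((hΔ.memLp m).toLp (Δ m)) ((hΔ.memLp n).toLp (Δ n)) = (fgnCov H (n - m) : ℂ) := by
  rw [inner_toLp_toLp]
  exact hΔ.cov n m

lemma tendsto_dyadicLevel_lt_atTop :
    Tendsto (fun J => (finite_dyadicLevel_lt J).toFinset) atTop atTop := by
  refine tendsto_atTop_finset_of_monotone (fun J J' h n hn => ?_) fun n => ⟨dyadicLevel n + 1, ?_⟩
  · simp only [Set.Finite.mem_toFinset, Set.mem_ofPred_eq] at hn ⊢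
    omega
  · simp

lemma hasGaussianLaw_dyadicPart (hΔ : IsFractionalGaussianNoise H Δ P) (j : ℕ)
    (t : UnitAddCircle) : HasGaussianLaw (dyadicPart a Δ j t) P := by
  let L : ℤ → ℂ →L[ℝ] ℂ := fun n => ContinuousLinearMap.lsmul ℝ ℂ (a n * fourier n t)
  have h := (hΔ.gaussian.comp_left L).hasGaussianLaw_fun_sum (I := dyadicBlock j)
  have e : dyadicPart a Δ j t = fun ω => ∑ n ∈ dyadicBlock j, L n (Δ n ω) := by
    funext ω
    refine Finset.sum_congr rfl fun n _ => ?_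
    simp only [L, ContinuousLinearMap.lsmul_apply, smul_eq_mul]
    ring
  rw [e]
  exact h

lemma integral_dyadicPart (hΔ : IsFractionalGaussianNoise H Δ P) (j : ℕ)
    (t : UnitAddCircle) : ∫ ω, dyadicPart a Δ j t ω ∂P = 0 := by
  have := hΔ.gaussian.isProbabilityMeasure
  unfold dyadicPart
  rw [integral_finsetSum]
  · refine Finset.sum_eq_zero fun n _ => ?_
    rw [integral_mul_const, integral_const_mul, hΔ.mean, mul_zero, zero_mul]
  · exact fun n _ => (((hΔ.memLp n).integrable (by norm_num)).const_mul _).mul_const _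

lemma eLpNorm_dyadicPart_le (hH : 1 / 2 ≤ H) (hH1 : H < 1)
    (hΔ : IsFractionalGaussianNoise H Δ P) (hK : 0 ≤ K)
    (ha : ∀ n, ‖a n‖ ≤ K * ((2 : ℝ) ^ (-α)) ^ dyadicLevel n) (j : ℕ) (t : UnitAddCircle) :
    eLpNorm (dyadicPart a Δ j t) 2 P ≤ ENNReal.ofReal (8 * K * ((2 : ℝ) ^ (H - α)) ^ j) := by
  have h := norm_sum_block_le hH hH1 hΔ.inner_toLp (a := fun n => a n * fourier n t) hK
    (fun n => by rw [norm_mul, norm_fourier_apply, mul_one]; exact ha n)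
    (F := dyadicBlock j) (fun n hn => mem_dyadicBlock.1 hn)
  have h2 : dyadicPart a Δ j t
      =ᵐ[P] (∑ n ∈ dyadicBlock j, (a n * fourier n t) • (hΔ.memLp n).toLp (Δ n) : Lp ℂ 2 P) := by
    filter_upwards [coeFn_sum_smul_toLp hΔ.memLp (fun n => a n * fourier n t) (dyadicBlock j)]
      with ω hω
    rw [hω, dyadicPart]
    exact Finset.sum_congr rfl fun n _ => by ring
  rw [eLpNorm_congr_ae h2, ← Lp.enorm_def, ← ofReal_norm]
  exact ENNReal.ofReal_le_ofReal h

/-- Almost surely the dyadic parts are bounded, uniformly in `t`, by a summable sequence. -/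
lemma ae_exists_summable_bound_dyadicPart (hH : 1 / 2 ≤ H) (hH1 : H < 1) (hα : H < α)
    (hΔ : IsFractionalGaussianNoise H Δ P) (hK : 0 ≤ K)
    (ha : ∀ n, ‖a n‖ ≤ K * ((2 : ℝ) ^ (-α)) ^ dyadicLevel n) :
    ∀ᵐ ω ∂P, ∃ B : ℕ → ℝ, Summable B ∧ ∀ j t, ‖dyadicPart a Δ j t ω‖ ≤ B j := by
  set r : ℝ := (2 : ℝ) ^ (H - α) with hr
  have hr0 : 0 < r := by positivity
  have hr1 : r < 1 := two_rpow_sub_lt_one hα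
  -- The decay `r ^ j` is split as `ρ ^ j * ρ ^ j`: one factor is the summable threshold for the
  -- maximum, the other, raised to the power `p`, pays for the number of samples.
  set ρ : ℝ := √r with hρ
  have hρ0 : 0 < ρ := Real.sqrt_pos.2 hr0
  have hρ1 : ρ < 1 := by rw [hρ, Real.sqrt_lt' one_pos]; simpa using hr1
  have hρr : ρ * ρ = r := Real.mul_self_sqrt hr0.le
  -- Block `j` needs at most `(4p + 1) 2 ^ j` samples; against `(ρ ^ p) ^ j ≤ 4 ^ (-j)` this leaves
  -- `2 ^ (-j)`, which is summable.
  obtain ⟨p, hp⟩ := exists_pow_lt_of_lt_one (by norm_num : (0 : ℝ) < 1 / 4) hρ1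
  choose τ hτ using fun j : ℕ => exists_trigPoly_sample (2 ^ (j + 1)) p
  set L : ℕ → ℕ := fun j => 2 * 2 ^ (j + 1) * p + 1 with hL
  set g : ℕ → Ω → ℝ := fun j ω => ∑ i ∈ Finset.range (L j), ‖dyadicPart a Δ j (τ j i) ω‖ ^ p
    with hg
  have hg0 : ∀ j ω, 0 ≤ g j ω := fun j ω => Finset.sum_nonneg fun _ _ => by positivity
  set w : ℕ → ℝ := fun j => ((ρ ^ j) ^ p)⁻¹ with hw
  have hw0 : ∀ j, 0 < w j := fun j => by positivity
  have hmeas : ∀ j t, AEMeasurable (dyadicPart a Δ j t) P :=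
    fun j t => (hasGaussianLaw_dyadicPart hΔ j t).aemeasurable
  have hgm : ∀ j, AEMeasurable (fun ω => ENNReal.ofReal (w j * g j ω)) P := fun j => by
    refine ((Finset.aemeasurable_fun_sum _ fun i _ => ?_).const_mul _).ennreal_ofReal
    exact (hmeas j _).norm.pow_const p
  set C : ENNReal := 2 ^ (p + 1) * gaussianAbsMoment p * ENNReal.ofReal (8 * K) ^ p with hC
  have hCtop : C ≠ ⊤ := by
    simp [hC, ENNReal.mul_eq_top, gaussianAbsMoment_ne_top]
  have hmoment : ∀ j t, ∫⁻ ω, ‖dyadicPart a Δ j t ω‖ₑ ^ p ∂P ≤ C * ENNReal.ofReal (r ^ j) ^ p := by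
    intro j t
    refine (lintegral_enorm_pow_le_of_hasGaussianLaw (hasGaussianLaw_dyadicPart hΔ j t)
      (integral_dyadicPart hΔ j t) p).trans ?_
    rw [hC, mul_assoc (_ * _), ← mul_pow, ← ENNReal.ofReal_mul (by positivity)]
    gcongr
    exact eLpNorm_dyadicPart_le hH hH1 hΔ hK ha j t
  have hint : ∀ j, ∫⁻ ω, ENNReal.ofReal (w j * g j ω) ∂P
      ≤ C * ENNReal.ofReal ((4 * p + 1) * (1 / 2) ^ j) := by
    intro j
    have h1 : ∀ ω, ENNReal.ofReal (w j * g j ω) = ENNReal.ofReal (w j) *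
        ∑ i ∈ Finset.range (L j), ‖dyadicPart a Δ j (τ j i) ω‖ₑ ^ p := by
      intro ω
      rw [ENNReal.ofReal_mul (hw0 j).le, hg, ENNReal.ofReal_sum_of_nonneg fun _ _ => by positivity]
      congr 1
      refine Finset.sum_congr rfl fun i _ => ?_
      rw [ENNReal.ofReal_pow (norm_nonneg _), ofReal_norm]
    simp_rw [h1]
    rw [lintegral_const_mul' _ _ (by simp), lintegral_finsetSum' _ fun i _ =>
      (hmeas j _).enorm.pow_const p]
    calc _ ≤ ENNReal.ofReal (w j) * ∑ i ∈ Finset.range (L j), C * ENNReal.ofReal (r ^ j) ^ p := by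
          gcongr; exact hmoment j _
      _ = C * ENNReal.ofReal (w j * L j * (r ^ j) ^ p) := by
          rw [Finset.sum_const, Finset.card_range, nsmul_eq_mul,
            ENNReal.ofReal_mul (by positivity), ENNReal.ofReal_mul (hw0 j).le,
            ENNReal.ofReal_natCast, ENNReal.ofReal_pow (by positivity) p]
          ring
      _ ≤ _ := by
          refine mul_le_mul' le_rfl (ENNReal.ofReal_le_ofReal ?_)
          have h2 : w j * (r ^ j) ^ p = (ρ ^ p) ^ j := by
            rw [hw, ← hρr, mul_pow, mul_pow, ← mul_assoc, inv_mul_cancel₀ (by positivity), one_mul,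
              ← pow_mul, ← pow_mul, mul_comm]
          have h3 : (ρ ^ p) ^ j ≤ (1 / 4) ^ j := by gcongr
          have h4 : (L j : ℝ) ≤ (4 * p + 1) * 2 ^ j := by
            have : (1 : ℝ) ≤ 2 ^ j := one_le_pow₀ (by norm_num)
            rw [hL]; push_cast; rw [pow_succ]; nlinarith
          calc w j * L j * (r ^ j) ^ p = L j * (ρ ^ p) ^ j := by rw [← h2]; ring
            _ ≤ ((4 * p + 1) * 2 ^ j) * (1 / 4) ^ j := by gcongr
            _ = _ := by rw [mul_assoc, ← mul_pow]; norm_num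
  have hsum : ∫⁻ ω, ∑' j, ENNReal.ofReal (w j * g j ω) ∂P ≠ ⊤ := by
    rw [lintegral_tsum hgm]
    refine ne_top_of_le_ne_top ?_ (ENNReal.tsum_le_tsum hint)
    rw [ENNReal.tsum_mul_left]
    refine ENNReal.mul_ne_top hCtop ?_
    have hs : Summable fun j : ℕ => (4 * (p : ℝ) + 1) * (1 / 2) ^ j :=
      (summable_geometric_of_lt_one (by norm_num) (by norm_num)).mul_left _
    rw [← ENNReal.ofReal_tsum_of_nonneg (fun j => by positivity) hs]
    exact ENNReal.ofReal_ne_top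
  filter_upwards [ae_lt_top' (AEMeasurable.tsum hgm) hsum] with ω hω
  have hs : Summable fun j => w j * g j ω := by
    have := ENNReal.summable_toReal hω.ne
    simpa [ENNReal.toReal_ofReal, mul_nonneg (hw0 _).le (hg0 _ ω)] using this
  refine ⟨fun j => ρ ^ j + w j * g j ω, (summable_geometric_of_lt_one hρ0.le hρ1).add hs,
    fun j t => ?_⟩
  have h1 : ‖dyadicPart a Δ j t ω‖ ^ p ≤ g j ω :=
    hτ j (dyadicBlock j) (fun n => a n * Δ n ω) (dyadicBlock_subset j) t
  set x := ‖dyadicPart a Δ j t ω‖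
  -- Above the threshold, `x / ρ ^ j > 1` is at most its `p`-th power, and `x ≤ x / ρ ^ j` because
  -- `ρ ≤ 1`. So `ρ ^ j + w j * g j ω` is a bound in both cases.
  by_cases hx : x ≤ ρ ^ j
  · exact hx.trans (le_add_of_nonneg_right (mul_nonneg (hw0 j).le (hg0 j ω)))
  · push Not at hx
    have hp0 : p ≠ 0 := by rintro rfl; norm_num at hp
    have h2 : 1 ≤ x / ρ ^ j := (one_le_div (by positivity)).2 hx.le
    have h3 : x / ρ ^ j ≤ (x / ρ ^ j) ^ p := le_self_pow₀ h2 hp0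
    have h4 : x ≤ x / ρ ^ j := by
      rw [le_div_iff₀ (by positivity)]
      exact mul_le_of_le_one_right (norm_nonneg _) (pow_le_one₀ hρ0.le hρ1.le)
    have h5 : (x / ρ ^ j) ^ p ≤ w j * g j ω := by
      rw [div_pow, div_eq_inv_mul]
      exact mul_le_mul_of_nonneg_left h1 (hw0 j).le
    have : 0 < ρ ^ j := by positivity
    linarith

theorem exists_isRandomFourierSum_hasBoundedPaths (hH : 1 / 2 ≤ H) (hH1 : H < 1) (hα : H < α)
    (hΔ : IsFractionalGaussianNoise H Δ P) {f : UnitAddCircle → ℂ} (hK : 0 ≤ K)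
    (hf : ∀ n, ‖fourierCoeff f n‖ ≤ K * ((2 : ℝ) ^ (-α)) ^ dyadicLevel n) :
    ∃ S : UnitAddCircle → Ω → ℂ, IsRandomFourierSum f Δ P S ∧ HasBoundedPaths S P := by
  have hsum : ∀ t : UnitAddCircle, Summable fun n =>
      (fourierCoeff f n * fourier n t) • (hΔ.memLp n).toLp (Δ n) := fun t =>
    summable_smul_of_fgnCov hH hH1 hα hΔ.inner_toLp hK
      (fun n => by rw [norm_mul, norm_fourier_apply, mul_one]; exact hf n)
  choose S hS using hsum
  refine ⟨fun t => S t, fun t => ⟨Lp.memLp _, ?_⟩, ?_⟩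
  · simpa only [mul_right_comm] using tendsto_eLpNorm_sum_sub hΔ.memLp (hS t)
  have hbound := ae_exists_summable_bound_dyadicPart hH hH1 hα hΔ hK hf
  -- The modification sums the blocks pointwise. It agrees almost surely with the `L²` sum because
  -- the partial sums over whole blocks converge to both.
  refine ⟨fun t ω => ∑' j, dyadicPart (fourierCoeff f) Δ j t ω, fun t => ?_, ?_⟩
  · refine ae_eq_of_tendsto_eLpNorm_of_tendsto_ae
      (T := fun J ω => ∑ j ∈ Finset.range J, dyadicPart (fourierCoeff f) Δ j t ω)
      (fun J => ?_) (Lp.aestronglyMeasurable _) ?_ ?_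
    · exact Finset.aestronglyMeasurable_fun_sum _ fun j _ =>
        (hasGaussianLaw_dyadicPart hΔ j t).aemeasurable.aestronglyMeasurable
    · simp_rw [sum_range_dyadicPart]
      exact (tendsto_eLpNorm_sum_sub hΔ.memLp (hS t)).comp tendsto_dyadicLevel_lt_atTop
    · filter_upwards [hbound] with ω ⟨B, hB, hle⟩
      exact (Summable.of_norm_bounded hB fun j => hle j t).hasSum.tendsto_sum_nat
  · filter_upwards [hbound] with ω ⟨B, hB, hle⟩
    exact ⟨∑' j, B j, fun t => tsum_of_norm_bounded hB.hasSum fun j => hle j t⟩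

end FractionalGaussianNoise

/-! ### The spectral measure of fractional Gaussian noise -/

/-- The even function `(1 - cos (2πx)) / |x| ^ (1 + 2H)`, a multiple of which is a density on `ℝ`
of (a lift of) the spectral measure of the fractional Gaussian noise. -/
noncomputable def fgnKernel (H x : ℝ) : ℝ := (1 - Real.cos (2 * Real.pi * x)) * |x| ^ (-1 - 2 * H)

lemma fgnKernel_nonneg (H x : ℝ) : 0 ≤ fgnKernel H x :=
  mul_nonneg (by linarith [Real.cos_le_one (2 * Real.pi * x)]) (by positivity)

lemma fgnKernel_neg (H x : ℝ) : fgnKernel H (-x) = fgnKernel H x := by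
  simp [fgnKernel]

lemma measurable_fgnKernel (H : ℝ) : Measurable (fgnKernel H) := by
  unfold fgnKernel
  fun_prop

/-- Near `0` the kernel is of order `|x| ^ (1 - 2H)`, integrable since `H < 1`; at infinity it is at
most `2 |x| ^ (-1 - 2H)`, integrable since `H > 0`. -/
lemma integrable_fgnKernel {H : ℝ} (hH : 0 < H) (hH1 : H < 1) : Integrable (fgnKernel H) := by
  have hm : ∀ s : Set ℝ, AEStronglyMeasurable (fgnKernel H) (volume.restrict s) :=
    fun s => (measurable_fgnKernel H).aestronglyMeasurable
  have h1 : IntegrableOn (fgnKernel H) (Set.Ioo 0 1) := by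
    have h := ((intervalIntegral.integrableOn_Ioo_rpow_iff (s := 1 - 2 * H) one_pos).2
      (by linarith)).const_mul ((2 * Real.pi) ^ 2 / 2)
    refine Integrable.mono' h (hm _) ((ae_restrict_mem measurableSet_Ioo).mono fun x hx => ?_)
    rw [Real.norm_of_nonneg (fgnKernel_nonneg H x), fgnKernel, abs_of_pos hx.1,
      show 1 - 2 * H = (2 : ℝ) + (-1 - 2 * H) by ring, Real.rpow_add hx.1, ← mul_assoc]
    refine mul_le_mul_of_nonneg_right ?_ (Real.rpow_nonneg hx.1.le _)
    have := Real.one_sub_sq_div_two_le_cos (x := 2 * Real.pi * x)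
    rw [Real.rpow_two]
    nlinarith
  have h2 : IntegrableOn (fgnKernel H) (Set.Ioi (1 / 2)) := by
    have h := (integrableOn_Ioi_rpow_of_lt (a := -1 - 2 * H) (by linarith)
      (by norm_num : (0 : ℝ) < 1 / 2)).const_mul 2
    refine Integrable.mono' h (hm _) ((ae_restrict_mem measurableSet_Ioi).mono fun x hx => ?_)
    have hx0 : 0 < x := lt_trans (by norm_num) (Set.mem_Ioi.1 hx)
    rw [Real.norm_of_nonneg (fgnKernel_nonneg H x), fgnKernel, abs_of_pos hx0]
    refine mul_le_mul_of_nonneg_right ?_ (Real.rpow_nonneg hx0.le _)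
    linarith [Real.neg_one_le_cos (2 * Real.pi * x)]
  have h3 : IntegrableOn (fgnKernel H) (Set.Ioi 0) := by
    refine (h1.union h2).mono_set fun x (hx : 0 < x) => ?_
    rcases lt_or_ge x 1 with h | h
    · exact Or.inl ⟨hx, h⟩
    · exact Or.inr (lt_of_lt_of_le (by norm_num) h)
  have h4 : IntegrableOn (fgnKernel H) (Set.Iio 0) := by
    have h := ((Measure.measurePreserving_neg (volume : Measure ℝ)).integrableOn_comp_preimage
      (Homeomorph.neg ℝ).measurableEmbedding).2 h3
    have e : fgnKernel H ∘ Neg.neg = fgnKernel H := funext fun x => fgnKernel_neg H x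
    rw [e] at h
    simpa using h
  rw [← integrableOn_univ, ← Set.Iic_union_Ioi (a := (0 : ℝ))]
  exact ((integrableOn_Iic_iff_integrableOn_Iio).2 h4).union h3

lemma integral_fgnKernel_pos {H : ℝ} (hH : 0 < H) (hH1 : H < 1) : 0 < ∫ x, fgnKernel H x := by
  rw [integral_pos_iff_support_of_nonneg (fgnKernel_nonneg H) (integrable_fgnKernel hH hH1)]
  refine lt_of_lt_of_le (by simp : 0 < volume (Set.Ioo (0 : ℝ) 1)) (measure_mono fun x hx => ?_)
  refine mul_ne_zero (fun h => ?_) (Real.rpow_pos_of_pos (abs_pos.2 hx.1.ne') _).ne'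
  have h1 : Real.cos (2 * Real.pi * x) = 1 := by linarith
  have hpi := Real.pi_pos
  rw [Real.cos_eq_one_iff_of_lt_of_lt (by nlinarith [hx.1]) (by nlinarith [hx.2])] at h1
  nlinarith [hx.1]

lemma one_sub_cos_mul_eq (H : ℝ) {a : ℝ} (ha : a ≠ 0) (x : ℝ) :
    (1 - Real.cos (2 * Real.pi * (a * x))) * |x| ^ (-1 - 2 * H)
      = |a| ^ (1 + 2 * H) * fgnKernel H (a * x) := by
  have h : |a| ^ (1 + 2 * H) * |a| ^ (-1 - 2 * H) = 1 := by
    rw [← Real.rpow_add (abs_pos.2 ha)]; simp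
  rw [fgnKernel, abs_mul, Real.mul_rpow (abs_nonneg _) (abs_nonneg _)]
  linear_combination (-(1 - Real.cos (2 * Real.pi * (a * x))) * |x| ^ (-1 - 2 * H)) * h

lemma integrable_one_sub_cos_mul {H : ℝ} (hH : 0 < H) (hH1 : H < 1) (a : ℝ) :
    Integrable fun x : ℝ => (1 - Real.cos (2 * Real.pi * (a * x))) * |x| ^ (-1 - 2 * H) := by
  by_cases ha : a = 0
  · simp [ha]
  simp_rw [one_sub_cos_mul_eq H ha]
  exact ((integrable_fgnKernel hH hH1).comp_mul_left' ha).const_mul _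

/-- The substitution `y = a x` produces the homogeneity `|a| ^ (2H)`, the source of the powers in
`fgnCov`. -/
lemma integral_one_sub_cos_mul {H : ℝ} (hH : 0 < H) (a : ℝ) :
    ∫ x : ℝ, (1 - Real.cos (2 * Real.pi * (a * x))) * |x| ^ (-1 - 2 * H)
      = |a| ^ (2 * H) * ∫ x, fgnKernel H x := by
  by_cases ha : a = 0
  · simp [ha, Real.zero_rpow (by positivity : 2 * H ≠ 0)]
  simp_rw [one_sub_cos_mul_eq H ha]
  rw [integral_const_mul, Measure.integral_comp_mul_left, smul_eq_mul, ← mul_assoc,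
    Real.rpow_add (abs_pos.2 ha), Real.rpow_one, abs_inv]
  field_simp [abs_pos.2 ha]

/-- By the addition formulas, `cos (2πkx) (1 - cos (2πx))` is the second difference in `k` of `1 -
cos (2πkx)`, and `fgnCov` is that of `|k| ^ (2H)`. -/
lemma integral_cos_mul_fgnKernel {H : ℝ} (hH : 0 < H) (hH1 : H < 1) (k : ℤ) :
    ∫ x, Real.cos (2 * Real.pi * (k * x)) * fgnKernel H x
      = fgnCov H k * ∫ x, fgnKernel H x := by
  have hint := integrable_one_sub_cos_mul hH hH1
  have h : ∀ x : ℝ, Real.cos (2 * Real.pi * (k * x)) * fgnKernel H x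
      = ((1 / 2 * ((1 - Real.cos (2 * Real.pi * ((k + 1) * x))) * |x| ^ (-1 - 2 * H))
        + 1 / 2 * ((1 - Real.cos (2 * Real.pi * ((k - 1) * x))) * |x| ^ (-1 - 2 * H)))
        - (1 - Real.cos (2 * Real.pi * (k * x))) * |x| ^ (-1 - 2 * H)) := by
    intro x
    rw [show 2 * Real.pi * ((k + 1) * x) = 2 * Real.pi * (k * x) + 2 * Real.pi * x by ring,
      show 2 * Real.pi * ((k - 1) * x) = 2 * Real.pi * (k * x) - 2 * Real.pi * x by ring,
      Real.cos_add, Real.cos_sub, fgnKernel]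
    ring
  have h12 : Integrable fun x : ℝ =>
      1 / 2 * ((1 - Real.cos (2 * Real.pi * ((k + 1) * x))) * |x| ^ (-1 - 2 * H))
        + 1 / 2 * ((1 - Real.cos (2 * Real.pi * ((k - 1) * x))) * |x| ^ (-1 - 2 * H)) :=
    ((hint _).const_mul _).add ((hint _).const_mul _)
  simp_rw [h]
  rw [integral_sub h12 (hint _),
    integral_add ((hint _).const_mul _) ((hint _).const_mul _), integral_const_mul,
    integral_const_mul]
  simp_rw [integral_one_sub_cos_mul hH]
  rw [fgnCov]
  ring

lemma integral_sin_mul_fgnKernel (H : ℝ) (k : ℤ) :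
    ∫ x, Real.sin (2 * Real.pi * (k * x)) * fgnKernel H x = 0 := by
  have h := integral_neg_eq_self (fun x => Real.sin (2 * Real.pi * (k * x)) * fgnKernel H x) volume
  simp only [fgnKernel_neg, mul_neg, Real.sin_neg, neg_mul, integral_neg] at h
  linarith

/-- The spectral measure of the fractional Gaussian noise. -/
noncomputable def fgnSpectralMeasure (H : ℝ) : Measure UnitAddCircle :=
  (volume.withDensity fun x => ENNReal.ofReal (fgnKernel H x / ∫ y, fgnKernel H y)).map
    (fun x : ℝ => (x : UnitAddCircle))

lemma measurable_coe_unitAddCircle : Measurable fun x : ℝ => (x : UnitAddCircle) :=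
  (AddCircle.continuous_mk' 1).measurable

lemma isSpectralMeasure_fgnSpectralMeasure {H : ℝ} (hH : 0 < H) (hH1 : H < 1) :
    IsSpectralMeasure (fun k => (fgnCov H k : ℂ)) (fgnSpectralMeasure H) := by
  set C := ∫ y, fgnKernel H y with hC
  have hC0 : 0 < C := integral_fgnKernel_pos hH hH1
  have hint := integrable_fgnKernel hH hH1
  have hd0 : ∀ x, 0 ≤ fgnKernel H x / C := fun x => div_nonneg (fgnKernel_nonneg H x) hC0.le
  have hdm : Measurable fun x => ENNReal.ofReal (fgnKernel H x / C) :=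
    ((measurable_fgnKernel H).div_const C).ennreal_ofReal
  constructor
  · have : IsProbabilityMeasure
        (volume.withDensity fun x => ENNReal.ofReal (fgnKernel H x / C)) := by
      constructor
      rw [withDensity_apply _ MeasurableSet.univ, Measure.restrict_univ,
        ← ofReal_integral_eq_lintegral_ofReal (hint.div_const C) (ae_of_all _ hd0),
        integral_div, ← hC, div_self hC0.ne', ENNReal.ofReal_one]
    exact Measure.isProbabilityMeasure_map measurable_coe_unitAddCircle.aemeasurable
  · intro k
    rw [fgnSpectralMeasure, integral_map measurable_coe_unitAddCircle.aemeasurable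
      (fourier k).continuous.aestronglyMeasurable,
      integral_withDensity_eq_integral_toReal_smul hdm (by simp)]
    have hdecomp : ∀ x : ℝ, (ENNReal.ofReal (fgnKernel H x / C)).toReal • (fourier k (x : UnitAddCircle) : ℂ)
        = ((Real.cos (2 * Real.pi * (k * x)) * fgnKernel H x / C : ℝ) : ℂ)
          + ((Real.sin (2 * Real.pi * (k * x)) * fgnKernel H x / C : ℝ) : ℂ) * Complex.I := by
      intro x
      rw [ENNReal.toReal_ofReal (hd0 x), fourier_coe_apply,
        show 2 * (Real.pi : ℂ) * Complex.I * k * x / (1 : ℝ)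
          = ((2 * Real.pi * (k * x) : ℝ) : ℂ) * Complex.I by push_cast; ring, Complex.exp_mul_I,
        Complex.real_smul]
      push_cast
      ring
    have hc : Integrable fun x : ℝ => Real.cos (2 * Real.pi * (k * x)) * fgnKernel H x / C :=
      (hint.bdd_mul (c := 1) (by fun_prop)
        (ae_of_all _ fun x => Real.abs_cos_le_one _)).div_const C
    have hs : Integrable fun x : ℝ => Real.sin (2 * Real.pi * (k * x)) * fgnKernel H x / C :=
      (hint.bdd_mul (c := 1) (by fun_prop)
        (ae_of_all _ fun x => Real.abs_sin_le_one _)).div_const C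
    simp_rw [hdecomp]
    rw [integral_add hc.ofReal (hs.ofReal.mul_const _), integral_mul_const, integral_complex_ofReal,
      integral_complex_ofReal, integral_div, integral_div, integral_cos_mul_fgnKernel hH hH1,
      integral_sin_mul_fgnKernel, ← hC, mul_div_cancel_right₀ _ hC0.ne']
    simp

/-- A null set of the circle lifts to a null set in each of countably many unit intervals, and the
lifted measure has a density on `ℝ`. -/
lemma fgnSpectralMeasure_absolutelyContinuous (H : ℝ) :
    fgnSpectralMeasure H ≪ AddCircle.haarAddCircle := by
  refine Measure.AbsolutelyContinuous.mk fun s hs h0 => ?_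
  rw [fgnSpectralMeasure, Measure.map_apply measurable_coe_unitAddCircle hs]
  refine withDensity_absolutelyContinuous _ _ ?_
  have hvol : (volume : Measure UnitAddCircle) s = 0 := by
    rw [AddCircle.volume_eq_smul_haarAddCircle]; simp [h0]
  set A := (fun x : ℝ => (x : UnitAddCircle)) ⁻¹' s with hA
  have hAm : MeasurableSet A := measurable_coe_unitAddCircle hs
  have h1 : ∀ n : ℤ, volume (A ∩ Set.Ioc (n : ℝ) (n + 1)) = 0 := by
    intro n
    rw [← Measure.restrict_apply hAm, hA]
    exact ((UnitAddCircle.measurePreserving_mk n).measure_preimage hs.nullMeasurableSet).trans hvol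
  have h2 : A = ⋃ n : ℤ, A ∩ Set.Ioc (n : ℝ) (n + 1) := by
    rw [← Set.inter_iUnion, iUnion_Ioc_intCast, Set.inter_univ]
  rw [h2]
  exact measure_iUnion_null h1

/-! ### Independent complex Gaussian variables -/

section WhiteNoise

/-- The product of centred normal distributions of variance `1 / 2`, two for each index. -/
noncomputable def whiteNoiseMeasure (ι : Type*) : Measure (ι × Bool → ℝ) :=
  Measure.infinitePi fun _ => gaussianReal 0 (1 / 2)

instance (ι : Type*) : IsProbabilityMeasure (whiteNoiseMeasure ι) := by
  unfold whiteNoiseMeasure; infer_instance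

variable {ι : Type*}

lemma iIndepFun_whiteNoise_coord :
    iIndepFun (fun (k : ι × Bool) (ω : ι × Bool → ℝ) => ω k) (whiteNoiseMeasure ι) :=
  iIndepFun_infinitePi (X := fun _ => id) fun _ => measurable_id

lemma map_whiteNoise_coord (k : ι × Bool) :
    (whiteNoiseMeasure ι).map (fun ω => ω k) = gaussianReal 0 (1 / 2) :=
  (measurePreserving_eval_infinitePi (fun _ : ι × Bool => gaussianReal 0 (1 / 2)) k).map_eq

lemma hasGaussianLaw_whiteNoise_coord (k : ι × Bool) :
    HasGaussianLaw (fun ω : ι × Bool → ℝ => ω k) (whiteNoiseMeasure ι) where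
  isGaussian_map := by rw [map_whiteNoise_coord]; infer_instance

lemma isGaussianProcess_whiteNoise_coord :
    IsGaussianProcess (fun (k : ι × Bool) (ω : ι × Bool → ℝ) => ω k) (whiteNoiseMeasure ι) where
  hasGaussianLaw I := iIndepFun.hasGaussianLaw (fun k : I => hasGaussianLaw_whiteNoise_coord k.1)
    (iIndepFun_whiteNoise_coord.precomp Subtype.val_injective)

lemma memLp_whiteNoise_coord (k : ι × Bool) :
    MemLp (fun ω : ι × Bool → ℝ => ω k) 2 (whiteNoiseMeasure ι) :=
  (hasGaussianLaw_whiteNoise_coord k).memLp (by simp)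

lemma integral_whiteNoise_coord (k : ι × Bool) : ∫ ω, ω k ∂whiteNoiseMeasure ι = 0 := by
  have h := integral_map (μ := whiteNoiseMeasure ι) (φ := fun ω => ω k) (f := fun x : ℝ => x)
    (measurable_pi_apply k).aemeasurable (by fun_prop)
  rw [← h, map_whiteNoise_coord, integral_id_gaussianReal]

lemma integral_whiteNoise_coord_mul [DecidableEq ι] (k l : ι × Bool) :
    ∫ ω, ω k * ω l ∂whiteNoiseMeasure ι = if k = l then 1 / 2 else 0 := by
  split_ifs with h
  · subst h
    have h1 := variance_of_integral_eq_zero (X := fun ω : ι × Bool → ℝ => ω k)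
      (μ := whiteNoiseMeasure ι) (measurable_pi_apply k).aemeasurable (integral_whiteNoise_coord k)
    have h2 := variance_map (μ := whiteNoiseMeasure ι) (Y := fun ω => ω k) (X := fun x : ℝ => x)
      (by fun_prop) (measurable_pi_apply k).aemeasurable
    rw [map_whiteNoise_coord, variance_fun_id_gaussianReal] at h2
    simp_rw [← sq]
    rw [← h1]
    simpa [Function.comp_def] using h2.symm
  · rw [(iIndepFun_whiteNoise_coord.indepFun h).integral_fun_mul_eq_mul_integral
      (measurable_pi_apply k).aestronglyMeasurable (measurable_pi_apply l).aestronglyMeasurable,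
      integral_whiteNoise_coord, zero_mul]

/-- Independent standard complex Gaussian variables. -/
def complexCoord (i : ι) (ω : ι × Bool → ℝ) : ℂ := ω (i, false) + ω (i, true) * Complex.I

lemma isGaussianProcess_complexCoord :
    IsGaussianProcess (complexCoord (ι := ι)) (whiteNoiseMeasure ι) := by
  classical
  refine isGaussianProcess_whiteNoise_coord.of_isGaussianProcess fun i =>
    ⟨{(i, false), (i, true)},
      (Complex.ofRealCLM ∘L ContinuousLinearMap.proj ⟨(i, false), by simp⟩)
      + (ContinuousLinearMap.lsmul ℝ ℂ Complex.I) ∘L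
        (Complex.ofRealCLM ∘L ContinuousLinearMap.proj ⟨(i, true), by simp⟩), fun ω => ?_⟩
  simp [complexCoord, mul_comm]

lemma memLp_complexCoord (i : ι) : MemLp (complexCoord i) 2 (whiteNoiseMeasure ι) :=
  (isGaussianProcess_complexCoord.hasGaussianLaw_eval i).memLp (by simp)

lemma integral_complexCoord (i : ι) : ∫ ω, complexCoord i ω ∂whiteNoiseMeasure ι = 0 := by
  have hk : ∀ k : ι × Bool, Integrable (fun ω : ι × Bool → ℝ => ω k) (whiteNoiseMeasure ι) :=
    fun k => (memLp_whiteNoise_coord k).integrable (by norm_num)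
  simp only [complexCoord]
  rw [integral_add (hk _).ofReal ((hk _).ofReal.mul_const _), integral_mul_const,
    integral_complex_ofReal, integral_complex_ofReal]
  simp [integral_whiteNoise_coord]

/-- One computation serves twice: `s = I` gives the vanishing pseudo-covariance, `s = -I` the
covariance. -/
lemma integral_complexCoord_mul_aux [DecidableEq ι] (i j : ι) (s : ℂ) :
    ∫ ω : ι × Bool → ℝ, (ω (i, false) + ω (i, true) * Complex.I) * (ω (j, false) + ω (j, true) * s)
      ∂whiteNoiseMeasure ι = if i = j then (1 + Complex.I * s) / 2 else 0 := by
  have hint : ∀ (k l : ι × Bool) (c : ℂ),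
      Integrable (fun ω : ι × Bool → ℝ => ((ω k * ω l : ℝ) : ℂ) * c) (whiteNoiseMeasure ι) :=
    fun k l c => ((memLp_whiteNoise_coord k).integrable_mul
      (memLp_whiteNoise_coord l)).ofReal.mul_const c
  have h : ∀ ω : ι × Bool → ℝ,
      (ω (i, false) + ω (i, true) * Complex.I : ℂ) * (ω (j, false) + ω (j, true) * s)
      = (((ω (i, false) * ω (j, false) : ℝ) : ℂ) * 1 + ((ω (i, true) * ω (j, true) : ℝ) : ℂ)
          * (Complex.I * s))
        + (((ω (i, false) * ω (j, true) : ℝ) : ℂ) * s + ((ω (i, true) * ω (j, false) : ℝ) : ℂ)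
          * Complex.I) := fun ω => by push_cast; ring
  simp_rw [h]
  have hint2 : ∀ (k l k' l' : ι × Bool) (c c' : ℂ), Integrable (fun ω : ι × Bool → ℝ =>
      ((ω k * ω l : ℝ) : ℂ) * c + ((ω k' * ω l' : ℝ) : ℂ) * c') (whiteNoiseMeasure ι) :=
    fun k l k' l' c c' => (hint k l c).add (hint k' l' c')
  rw [integral_add (hint2 _ _ _ _ _ _) (hint2 _ _ _ _ _ _),
    integral_add (hint _ _ _) (hint _ _ _), integral_add (hint _ _ _) (hint _ _ _)]
  simp_rw [integral_mul_const, integral_complex_ofReal, integral_whiteNoise_coord_mul]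
  by_cases hij : i = j <;> simp [hij]
  ring

lemma integral_complexCoord_mul (i j : ι) :
    ∫ ω, complexCoord i ω * complexCoord j ω ∂whiteNoiseMeasure ι = 0 := by
  classical
  simpa [complexCoord] using integral_complexCoord_mul_aux i j Complex.I

lemma orthonormal_complexCoord :
    Orthonormal ℂ fun i : ι => (memLp_complexCoord i).toLp (complexCoord i) := by
  classical
  rw [orthonormal_iff_ite]
  intro i j
  rw [inner_toLp_toLp]
  have h := integral_complexCoord_mul_aux j i (-Complex.I)
  have e : ∀ ω : ι × Bool → ℝ, complexCoord j ω * conj (complexCoord i ω)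
      = (ω (j, false) + ω (j, true) * Complex.I) * (ω (i, false) + ω (i, true) * -Complex.I) := by
    intro ω
    simp [complexCoord]
  simp_rw [e, h]
  by_cases hij : i = j
  · simp [hij]
  · simp [hij, Ne.symm hij]

end WhiteNoise

/-! ### Gaussian laws in `L²` and the isonormal process -/

section Law

variable {Ω : Type*} [MeasurableSpace Ω] {P : Measure Ω}

lemma norm_exp_mul_I_sub_le (a b : ℝ) :
    ‖Complex.exp (a * Complex.I) - Complex.exp (b * Complex.I)‖ ≤ |a - b| := by
  have h : Complex.exp (a * Complex.I) - Complex.exp (b * Complex.I)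
      = Complex.exp (b * Complex.I) * (Complex.exp (Complex.I * (a - b : ℝ)) - 1) := by
    rw [mul_sub, ← Complex.exp_add, mul_one]
    congr 2
    push_cast; ring
  rw [h, norm_mul, Complex.norm_exp_ofReal_mul_I, one_mul]
  exact Real.norm_exp_I_mul_ofReal_sub_one_le

/-- The characteristic function of the real part depends continuously on a variable in `L²`. -/
lemma continuous_charFun_map_re [IsProbabilityMeasure P] (t : ℝ) :
    Continuous fun Z : Lp ℂ 2 P => charFun (P.map fun ω => (Z ω).re) t := by
  have hm : ∀ Z : Lp ℂ 2 P, AEStronglyMeasurable (fun ω => (Z ω).re) P :=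
    fun Z => (Lp.aestronglyMeasurable Z).re
  have hchar : ∀ Z : Lp ℂ 2 P, charFun (P.map fun ω => (Z ω).re) t
      = ∫ ω, Complex.exp ((t * (Z ω).re : ℝ) * Complex.I) ∂P := by
    intro Z
    rw [charFun_apply_real, integral_map (hm Z).aemeasurable (by fun_prop)]
    push_cast; rfl
  simp_rw [hchar]
  have hint : ∀ Z : Lp ℂ 2 P, Integrable
      (fun ω => Complex.exp ((t * (Z ω).re : ℝ) * Complex.I)) P := by
    intro Z
    refine Integrable.of_bound (C := 1) ?_ (ae_of_all _ fun ω => ?_)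
    · have := (hm Z).aemeasurable
      exact AEMeasurable.aestronglyMeasurable (by fun_prop)
    · exact (Complex.norm_exp_ofReal_mul_I _).le
  refine LipschitzWith.continuous (K := ‖t‖₊) (LipschitzWith.of_dist_le_mul fun Z Z' => ?_)
  have hL2 : MemLp (Z - Z' : Lp ℂ 2 P) 2 P := Lp.memLp _
  have hL1 : ∫ ω, ‖(Z - Z' : Lp ℂ 2 P) ω‖ ∂P ≤ ‖Z - Z'‖ := by
    have h := eLpNorm_le_eLpNorm_of_exponent_le (p := 1) (q := 2) (by norm_num) hL2.1
    rw [integral_norm_eq_lintegral_enorm hL2.1, ← eLpNorm_one_eq_lintegral_enorm, Lp.norm_def]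
    exact ENNReal.toReal_mono hL2.2.ne h
  rw [dist_eq_norm, dist_eq_norm, ← integral_sub (hint Z) (hint Z')]
  calc _ ≤ ∫ ω, ‖t‖ * ‖(Z - Z' : Lp ℂ 2 P) ω‖ ∂P := by
        refine norm_integral_le_of_norm_le
          ((hL2.integrable (by norm_num)).norm.const_mul _) ?_
        filter_upwards [Lp.coeFn_sub Z Z'] with ω hω
        refine (norm_exp_mul_I_sub_le _ _).trans ?_
        rw [← mul_sub, abs_mul, hω, Pi.sub_apply, ← Complex.sub_re]
        exact mul_le_mul_of_nonneg_left (Complex.abs_re_le_norm _) (abs_nonneg _)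
    _ ≤ _ := by
        rw [integral_const_mul]
        exact mul_le_mul_of_nonneg_left hL1 (norm_nonneg _)

/-- Pseudo-covariances become inner products, so they too can be shown to vanish by linearity and
density. -/
lemma inner_star_left (X Y : Lp ℂ 2 P) : inner ℂ (star X) Y = ∫ ω, Y ω * X ω ∂P := by
  rw [L2.inner_def]
  refine integral_congr_ae ?_
  filter_upwards [Lp.coeFn_star X] with ω hω
  rw [hω]
  simp

/-- A linear family of complex variables is a Gaussian process if the real parts are Gaussian. -/
lemma isGaussianProcess_of_re {E : Type*} [AddCommGroup E] [Module ℂ E]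
    (W : E →ₗ[ℂ] Lp ℂ 2 P) (hW : ∀ φ, HasGaussianLaw (fun ω => (W φ ω).re) P) :
    IsGaussianProcess (fun φ ω => W φ ω) P where
  hasGaussianLaw I := by
    classical
    have hm : AEMeasurable (fun ω => I.restrict fun φ => W φ ω) P :=
      aemeasurable_pi_iff.2 fun φ => (Lp.aestronglyMeasurable (W φ)).aemeasurable
    refine ⟨isGaussian_of_isGaussian_map fun L => ?_⟩
    rw [AEMeasurable.map_map_of_aemeasurable (by fun_prop) hm]
    -- Every real-linear functional on `ℂ ^ I` is the real part of a complex-linear one, with these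
    -- coefficients. Complex linearity of `W` then reduces joint Gaussianity to the real part of a
    -- single `W φ`.
    let c : I → ℂ := fun i => L (Pi.single i 1) - L (Pi.single i Complex.I) * Complex.I
    have hL : ∀ x : I → ℂ, L x = (∑ i, c i * x i).re := by
      intro x
      have hx : x = ∑ i, ((x i).re • (Pi.single i 1 : I → ℂ)
          + (x i).im • (Pi.single i Complex.I : I → ℂ)) := by
        ext j
        rw [Finset.sum_apply, Finset.sum_eq_single j]
        · simp
        · intro i _ hij
          simp [Pi.single_eq_of_ne hij.symm]
        · simp
      conv_lhs => rw [hx]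
      rw [map_sum, Complex.re_sum]
      refine Finset.sum_congr rfl fun i _ => ?_
      rw [map_add, map_smul, map_smul]
      simp [c]
      ring
    have hsum : (fun ω => (W (∑ i : I, c i • (i : E)) ω).re)
        =ᵐ[P] L ∘ fun ω => I.restrict fun φ => W φ ω := by
      have h := coeFn_sum_smul_toLp (P := P) (ξ := fun i : I => (W i : Ω → ℂ))
        (fun i => Lp.memLp _) c Finset.univ
      simp only [Lp.toLp_coeFn] at h
      rw [map_sum]
      simp_rw [map_smul]
      filter_upwards [h] with ω hω
      rw [hω, Function.comp_apply, hL]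
      rfl
    exact ((hW _).congr hsum).isGaussian_map

end Law

/-- The complex isonormal process over a Hilbert space. -/
theorem exists_isonormal (E : Type) [NormedAddCommGroup E] [InnerProductSpace ℂ E]
    [CompleteSpace E] : ∃ (Ω : Type) (_ : MeasurableSpace Ω) (P : Measure Ω)
      (_ : IsProbabilityMeasure P) (W : E →ₗᵢ[ℂ] Lp ℂ 2 P),
      IsComplexGaussianProcess (fun φ ω => W φ ω) (fun φ ψ => inner ℂ ψ φ) P := by
  classical
  obtain ⟨ι, b, -⟩ := exists_hilbertBasis ℂ E
  let P := whiteNoiseMeasure ι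
  let ζ : ι → Lp ℂ 2 P := fun i => (memLp_complexCoord i).toLp (complexCoord i)
  have hζ : Orthonormal ℂ ζ := orthonormal_complexCoord
  let W : E →ₗᵢ[ℂ] Lp ℂ 2 P :=
    hζ.orthogonalFamily.linearIsometry.comp b.repr.toLinearIsometry
  have hWb : ∀ i, W (b i) = ζ i := by
    intro i
    simp only [W, LinearIsometry.coe_comp, Function.comp_apply,
      LinearIsometryEquiv.coe_toLinearIsometry, b.repr_self]
    rw [OrthogonalFamily.linearIsometry_apply_single]
    simp
  have hdense : Dense (Submodule.span ℂ (Set.range b) : Set E) := by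
    rw [← Submodule.dense_iff_topologicalClosure_eq_top.symm]
    exact b.dense_span
  -- A continuous functional vanishing on the basis vanishes everywhere; this extends the mean and
  -- the pseudo-covariance from the `ζ i` to all of `E`.
  have hvanish : ∀ X : Lp ℂ 2 P, (∀ i, inner ℂ X (ζ i) = 0) → ∀ φ, inner ℂ X (W φ) = 0 := by
    intro X hX φ
    have h : (innerSL ℂ X) ∘L W.toContinuousLinearMap = 0 := by
      refine ContinuousLinearMap.ext_on hdense ?_
      rintro _ ⟨i, rfl⟩
      simpa [hWb] using hX i
    exact DFunLike.congr_fun h φ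
  have hmean : ∀ φ, ∫ ω, W φ ω ∂P = 0 := by
    have key : ∀ Z : Lp ℂ 2 P,
        inner ℂ ((memLp_const (1 : ℂ)).toLp (fun _ => (1 : ℂ)) : Lp ℂ 2 P) Z = ∫ ω, Z ω ∂P := by
      intro Z
      have h := inner_toLp_toLp (Lp.memLp Z) (memLp_const (μ := P) (p := 2) (1 : ℂ))
      rw [Lp.toLp_coeFn] at h
      simpa using h
    intro φ
    rw [← key]
    refine hvanish _ (fun i => ?_) φ
    rw [key, integral_congr_ae (memLp_complexCoord i).coeFn_toLp]
    exact integral_complexCoord i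
  have hpseudo : ∀ φ ψ, ∫ ω, W φ ω * W ψ ω ∂P = 0 := by
    have h1 : ∀ j φ, inner ℂ (star (ζ j)) (W φ) = 0 := by
      intro j
      refine hvanish _ fun i => ?_
      rw [inner_star_left]
      refine Eq.trans (integral_congr_ae ?_) (integral_complexCoord_mul i j)
      filter_upwards [(memLp_complexCoord i).coeFn_toLp, (memLp_complexCoord j).coeFn_toLp]
        with ω h1 h2
      rw [h1, h2]
    intro φ ψ
    rw [← inner_star_left]
    refine hvanish _ (fun i => ?_) φ
    rw [inner_star_left]
    refine (integral_congr_ae (ae_of_all _ fun ω => mul_comm _ _)).trans ?_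
    rw [← inner_star_left]
    exact h1 i ψ
  have hcov : ∀ φ ψ, ∫ ω, W φ ω * conj (W ψ ω) ∂P = inner ℂ ψ φ := by
    intro φ ψ
    rw [← W.inner_map_map, L2.inner_def]
    rfl
  -- Since `(Re z)² = Re (z² + |z|²) / 2` and the pseudo-covariance is zero, the real part carries
  -- half the variance.
  have hre2 : ∀ φ, ∫ ω, (W φ ω).re ^ 2 ∂P = ‖φ‖ ^ 2 / 2 := by
    intro φ
    have hL2 : MemLp (W φ) 2 P := Lp.memLp _
    have i1 : Integrable (fun ω => W φ ω * W φ ω) P := hL2.integrable_mul hL2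
    have i2 : Integrable (fun ω => W φ ω * conj (W φ ω)) P := hL2.integrable_mul hL2.star
    have h1 : ∀ ω, (W φ ω).re ^ 2 = (W φ ω * W φ ω + W φ ω * conj (W φ ω)).re / 2 := by
      intro ω
      simp only [Complex.add_re, Complex.mul_re, Complex.conj_re, Complex.conj_im]
      ring
    simp_rw [h1]
    have h2 := integral_re (i1.add i2)
    simp only [Pi.add_apply, RCLike.re_to_complex] at h2
    rw [integral_div, h2, integral_add i1 i2, hpseudo, hcov, zero_add,
      inner_self_eq_norm_sq_to_K]
    norm_cast
  have hspan : ∀ φ ∈ Submodule.span ℂ (Set.range b), HasGaussianLaw (fun ω => (W φ ω).re) P := by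
    intro φ hφ
    obtain ⟨c, rfl⟩ := (Finsupp.mem_span_range_iff_exists_finsupp).1 hφ
    let L : ι → ℂ →L[ℝ] ℂ := fun i => ContinuousLinearMap.lsmul ℝ ℂ (c i)
    have h := ((isGaussianProcess_complexCoord (ι := ι)).comp_left L).hasGaussianLaw_fun_sum
      (I := c.support)
    have h2 : HasGaussianLaw (fun ω => (∑ i ∈ c.support, L i (complexCoord i ω)).re) P :=
      h.map Complex.reCLM
    refine h2.congr ?_
    rw [Finsupp.sum, map_sum]
    simp_rw [map_smul, hWb]
    filter_upwards [coeFn_sum_smul_toLp memLp_complexCoord c c.support] with ω hω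
    rw [hω]
    rfl
  -- Both sides are continuous in `φ` and agree on the dense span, where `W φ` is a finite
  -- combination of Gaussian variables. Thus Gaussianity passes to the limit.
  have hchar : ∀ (t : ℝ) φ, charFun (P.map fun ω => (W φ ω).re) t
      = charFun (gaussianReal 0 (‖φ‖₊ ^ 2 / 2)) t := by
    intro t φ
    have hc : Continuous fun φ : E => charFun (P.map fun ω => (W φ ω).re) t :=
      (continuous_charFun_map_re t).comp W.continuous
    have hc2 : Continuous fun φ : E => charFun (gaussianReal 0 (‖φ‖₊ ^ 2 / 2)) t := by
      simp_rw [charFun_gaussianReal]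
      push_cast
      fun_prop
    refine congrFun (hc.ext_on hdense hc2 fun φ hφ => ?_) φ
    have hG := hspan φ hφ
    have h0 : ∫ ω, (W φ ω).re ∂P = 0 := by
      have := integral_re ((Lp.memLp (W φ)).integrable (by norm_num : (1 : ENNReal) ≤ 2))
      rw [hmean] at this
      simpa using this
    simp only
    rw [hG.map_eq_gaussianReal, h0, variance_of_integral_eq_zero hG.aemeasurable h0, hre2]
    congr 2
    ext
    rw [Real.coe_toNNReal _ (by positivity)]
    push_cast
    rfl
  refine ⟨_, _, P, inferInstance, W, ?_, hmean, hcov, hpseudo⟩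
  refine isGaussianProcess_of_re W.toLinearMap fun φ => ⟨?_⟩
  have hm : AEMeasurable (fun ω => (W φ ω).re) P := (Lp.aestronglyMeasurable (W φ)).re.aemeasurable
  have := Measure.isProbabilityMeasure_map hm
  have h : P.map (fun ω => (W φ ω).re) = gaussianReal 0 (‖φ‖₊ ^ 2 / 2) :=
    Measure.ext_of_charFun (funext fun t => hchar t φ)
  change IsGaussian (P.map fun ω => (W φ ω).re)
  rw [h]
  infer_instance

/-! ### Translates of `f` and the process `X_f` -/

lemma IsComplexGaussianProcess.comp {S T Ω : Type*} [MeasurableSpace Ω] {X : T → Ω → ℂ}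
    {Γ : T → T → ℂ} {P : Measure Ω} (h : IsComplexGaussianProcess X Γ P) (g : S → T) :
    IsComplexGaussianProcess (fun s => X (g s)) (fun s t => Γ (g s) (g t)) P where
  gaussian := h.gaussian.comp_right g
  mean _ := h.mean _
  cov _ _ := h.cov _ _
  pseudoCov _ _ := h.pseudoCov _ _

lemma fourier_add_apply (n : ℤ) (x y : UnitAddCircle) :
    (fourier n (x + y) : ℂ) = fourier n x * fourier n y := by
  simp [fourier_apply, smul_add, AddCircle.toCircle_add]

lemma fourierCoeff_translate (f : UnitAddCircle → ℂ) (t : UnitAddCircle) (n : ℤ) :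
    fourierCoeff (fun u => f (t + u)) n = fourierCoeff f n * fourier n t := by
  have h : ∀ u, (fourier (-n) u : ℂ) • f (t + u)
      = fourier n t * ((fourier (-n) (t + u) : ℂ) • f (t + u)) := by
    intro u
    have h1 : (fourier n t : ℂ) * fourier (-n) t = 1 := by
      rw [← fourier_add, add_neg_cancel, fourier_zero]
    rw [fourier_add_apply, smul_eq_mul, smul_eq_mul]
    linear_combination (-(fourier (-n) u : ℂ) * f (t + u)) * h1
  rw [fourierCoeff, fourierCoeff]
  simp_rw [h]
  rw [integral_const_mul, mul_comm,
    integral_add_left_eq_self (μ := AddCircle.haarAddCircle) (fun v => (fourier (-n) v : ℂ) • f v) t]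

/-- The translate `u ↦ f (t + u)`. -/
noncomputable def circleTranslate (f : C(UnitAddCircle, ℂ)) (t : UnitAddCircle) : C(UnitAddCircle, ℂ) :=
  ⟨fun u => f (t + u), by fun_prop⟩

section SpectralMeasure

variable {μ : Measure UnitAddCircle} {H α K : ℝ}

lemma memLp_fourier [IsFiniteMeasure μ] (n : ℤ) : MemLp (fun u => (fourier n u : ℂ)) 2 μ :=
  MemLp.of_bound (fourier n).continuous.aestronglyMeasurable 1
    (ae_of_all _ fun u => (norm_fourier_apply n u).le)

lemma IsSpectralMeasure.inner_fourier [IsFiniteMeasure μ]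
    (hμ : IsSpectralMeasure (fun k => (fgnCov H k : ℂ)) μ) (n m : ℤ) :
    inner ℂ ((memLp_fourier m).toLp _ : Lp ℂ 2 μ) ((memLp_fourier n).toLp _)
      = (fgnCov H (n - m) : ℂ) := by
  rw [inner_toLp_toLp]
  refine Eq.trans ?_ (hμ.2 (n - m))
  refine integral_congr_ae (ae_of_all _ fun u => ?_)
  simp only
  rw [← fourier_neg, ← fourier_add, sub_eq_add_neg]

/-- The Fourier series of a translate of `f` converges to it in `L²` of the spectral measure. -/
lemma hasSum_fourier_translate [IsFiniteMeasure μ] (hH : 1 / 2 ≤ H) (hH1 : H < 1) (hα : H < α)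
    (hμ : IsSpectralMeasure (fun k => (fgnCov H k : ℂ)) μ) (hac : μ ≪ AddCircle.haarAddCircle)
    (hK : 0 ≤ K) (f : C(UnitAddCircle, ℂ))
    (hf : ∀ n, ‖fourierCoeff f n‖ ≤ K * ((2 : ℝ) ^ (-α)) ^ dyadicLevel n) (t : UnitAddCircle) :
    HasSum (fun n : ℤ => (fourierCoeff f n * fourier n t) •
      ((memLp_fourier n).toLp _ : Lp ℂ 2 μ)) (ContinuousMap.toLp 2 μ ℂ (circleTranslate f t)) := by
  obtain ⟨g, hg⟩ := summable_smul_of_fgnCov hH hH1 hα hμ.inner_fourier hK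
    (a := fun n => fourierCoeff f n * fourier n t)
    (fun n => by rw [norm_mul, norm_fourier_apply, mul_one]; exact hf n)
  suffices h : ContinuousMap.toLp 2 μ ℂ (circleTranslate f t) = g by rwa [h]
  let φ : Lp ℂ 2 (AddCircle.haarAddCircle (T := 1)) := ContinuousMap.toLp 2 _ ℂ (circleTranslate f t)
  have hφ : φ =ᵐ[AddCircle.haarAddCircle] circleTranslate f t := ContinuousMap.coeFn_toLp _ _
  have hcoeff : ∀ n, fourierCoeff φ n = fourierCoeff f n * fourier n t := by
    intro n
    rw [← fourierCoeff_translate]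
    refine integral_congr_ae ?_
    filter_upwards [hφ] with u hu
    rw [hu]; rfl
  have hhaar : HasSum (fun n : ℤ => (fourierCoeff f n * fourier n t) •
      ((memLp_fourier n).toLp _ : Lp ℂ 2 (AddCircle.haarAddCircle (T := 1)))) φ := by
    have h := hasSum_fourier_series_L2 φ
    simp_rw [hcoeff] at h
    exact h
  let T : ℕ → UnitAddCircle → ℂ := fun J u => ∑ n ∈ (finite_dyadicLevel_lt J).toFinset,
    fourierCoeff f n * fourier n t * fourier n u
  have hT : ∀ J, Continuous (T J) := fun J => by fun_prop
  have hTφ := (tendsto_eLpNorm_sum_sub memLp_fourier hhaar).comp tendsto_dyadicLevel_lt_atTop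
  have hTg := (tendsto_eLpNorm_sum_sub memLp_fourier hg).comp tendsto_dyadicLevel_lt_atTop
  -- Along a subsequence the partial sums converge to the translate Haar-almost everywhere, hence
  -- `μ`-almost everywhere by absolute continuity. This identifies it with the `L²(μ)` limit `g`.
  obtain ⟨ns, hns, hlim⟩ := (tendstoInMeasure_of_tendsto_eLpNorm (f := T) (g := φ) (by simp)
    (fun J => (hT J).aestronglyMeasurable) (Lp.aestronglyMeasurable _)
    hTφ).exists_seq_tendsto_ae
  have hae : circleTranslate f t =ᵐ[μ] g := by
    refine ae_eq_of_tendsto_eLpNorm_of_tendsto_ae (T := fun i => T (ns i))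
      (fun i => (hT _).aestronglyMeasurable) (Lp.aestronglyMeasurable _)
      (hTg.comp hns.tendsto_atTop) ?_
    filter_upwards [hac.ae_le hlim, hac.ae_le hφ] with u h1 h2
    rwa [← h2]
  exact Lp.ext ((ContinuousMap.coeFn_toLp _ _).trans hae)

/-- The isonormal process over `L²(μ)` carries the noise and `X_f` on one probability space;
applying `W` to the Fourier series of a translate shows that `X_f(t)` is almost surely the random
sum `S(t)`. -/
theorem mem_pisierClass_of_fourierCoeff_le (hH : 1 / 2 ≤ H) (hH1 : H < 1) (hα : H < α)
    (hμ : IsSpectralMeasure (fun k => (fgnCov H k : ℂ)) μ) (hac : μ ≪ AddCircle.haarAddCircle)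
    (hK : 0 ≤ K) (f : C(UnitAddCircle, ℂ))
    (hf : ∀ n, ‖fourierCoeff f n‖ ≤ K * ((2 : ℝ) ^ (-α)) ^ dyadicLevel n) :
    f ∈ pisierClass μ := by
  have := hμ.1
  obtain ⟨Ω, mΩ, P, hP, W, hW⟩ := exists_isonormal (Lp ℂ 2 μ)
  have hX := hW.comp fun t => ContinuousMap.toLp 2 μ ℂ (circleTranslate f t)
  let Δ : ℤ → Ω → ℂ := fun n => W ((memLp_fourier n).toLp _)
  have hΔ : IsFractionalGaussianNoise H Δ P := by
    have h := hW.comp fun n : ℤ => ((memLp_fourier n).toLp _ : Lp ℂ 2 μ)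
    simp_rw [hμ.inner_fourier] at h
    exact h
  obtain ⟨S, hS, Y, hY, hbdd⟩ := exists_isRandomFourierSum_hasBoundedPaths hH hH1 hα hΔ hK hf
  refine ⟨Ω, mΩ, P, fun t => W (ContinuousMap.toLp 2 μ ℂ (circleTranslate f t)), hP, ?_, Y,
    fun t => (hY t).trans ?_, hbdd⟩
  · simp_rw [ContinuousMap.inner_toLp] at hX
    exact hX
  · have hsum := (hasSum_fourier_translate hH hH1 hα hμ hac hK f hf t).mapL
      W.toContinuousLinearMap
    simp only [map_smul] at hsum
    have hm : ∀ n : ℤ, (W ((memLp_fourier n).toLp _) : Lp ℂ 2 P)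
        = (hΔ.memLp n).toLp (Δ n) := fun n => (Lp.toLp_coeFn _ _).symm
    simp only [LinearIsometry.coe_toContinuousLinearMap, hm] at hsum
    have h1 := tendsto_eLpNorm_sum_sub hΔ.memLp hsum
    obtain ⟨hSm, h2⟩ := hS t
    simp only [mul_right_comm _ _ ((fourier _ t : ℂ))] at h2
    set Z : Lp ℂ 2 P := W (ContinuousMap.toLp 2 μ ℂ (circleTranslate f t))
    -- The same partial sums converge in `L²` to both `S t` and `Z`, so the triangle inequality
    -- makes the distance zero.
    have h3 : eLpNorm (fun ω => S t ω - Z ω) 2 P ≤ 0 := by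
      refine ge_of_tendsto' (by simpa using h1.add h2) fun F => ?_
      have hFm : AEStronglyMeasurable (fun ω => ∑ n ∈ F, fourierCoeff f n * fourier n t * Δ n ω) P :=
        Finset.aestronglyMeasurable_fun_sum _ fun n _ => (hΔ.memLp n).1.const_mul _
      refine le_trans (le_of_eq ?_) (eLpNorm_sub_le
        (hFm.sub (Lp.aestronglyMeasurable Z)) (hFm.sub hSm.1) (by norm_num))
      congr 1
      funext ω
      simp
    have h4 := (eLpNorm_eq_zero_iff (hSm.1.sub (Lp.aestronglyMeasurable Z)) (by simp)).1
      (le_antisymm h3 bot_le)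
    filter_upwards [h4] with ω hω
    exact sub_eq_zero.1 hω

end SpectralMeasure

theorem mainTheorem5 (H : ℝ) (hH : 1 / 2 ≤ H) (hH1 : H < 1)
    (f : UnitAddCircle → ℂ) (hf : MemLp f 2 AddCircle.haarAddCircle)
    (α K : ℝ) (hα : H < α) (hK : 0 < K)
    (hdecay : ∀ n : ℤ, n ≠ 0 → ‖fourierCoeff f n‖ ≤ K * |(n : ℝ)| ^ (-α)) :
    (∀ (Ω : Type*) [MeasurableSpace Ω] (P : Measure Ω) [IsProbabilityMeasure P]
        (Δ : ℤ → Ω → ℂ), IsFractionalGaussianNoise H Δ P →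
        ∃ S : UnitAddCircle → Ω → ℂ, IsRandomFourierSum f Δ P S ∧ HasBoundedPaths S P) ∧
    (∀ hc : Continuous f, ¬ Summable (fun n : ℤ => ‖fourierCoeff f n‖) →
        (⟨f, hc⟩ : C(UnitAddCircle, ℂ)) ∈ pisierClassFGN H ∧
        (⟨f, hc⟩ : C(UnitAddCircle, ℂ)) ∉ wienerAlgebra) := by
  have hH0 : 0 < H := by linarith
  obtain ⟨K', hK', hbound⟩ := exists_dyadic_bound (hH0.trans hα) hdecay
  refine ⟨fun Ω _ P _ Δ hΔ => exists_isRandomFourierSum_hasBoundedPaths hH hH1 hα hΔ hK' hbound,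
    fun hc hns => ⟨⟨fgnSpectralMeasure H, isSpectralMeasure_fgnSpectralMeasure hH0 hH1, ?_⟩, hns⟩⟩
  exact mem_pisierClass_of_fourierCoeff_le hH hH1 hα
    (isSpectralMeasure_fgnSpectralMeasure hH0 hH1) (fgnSpectralMeasure_absolutelyContinuous H)
    hK' ⟨f, hc⟩ hbound
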